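/- **Conventions.** Let $\Delta$ be the category of the finite ordinals $[m]=\{0<\dots<m\}$, $m\ge 0$, and order-preserving maps. For $1\le j\le m$ let $i_j:[m]\to[1]$ be the arrow of $\Delta^{op}$ that is opposite to the map $[1]\to[m]$, $0\mapsto j-1$, $1\mapsto j$. *Top* is the category of compactly generated Hausdorff spaces, and products (in particular powers) of spaces are taken there; *Cat* is the category of small categories; $B=|\ |\circ N:\mathit{Cat}\to\mathit{Top}$ is the classifying space functor (geometric realization of the nerve). **Lax functors.** A lax functor $W:\mathcal A\to\mathit{Cat}$ from a category $\mathcal A$ consists of categories $W_a$, functors $W(f):W_a\to W_b$ for $f:a\to b$, and natural transformations $1_{W_a}\Rightarrow W(1_a)$ and $W(g)W(f)\Rightarrow W(gf)$ satisfying the usual unit and associativity laws. A genuine functor is a lax functor with identity structure transformations. A lax functor $W:\Delta^{op}\to\mathit{Cat}$ is *Segal's* if for every $m\ge 0$ the functor $$p_m=\langle W(i_1),\dots,W(i_m)\rangle: W_m\to (W_1)^m$$ ($p_0$ being the unique functor from $W_0$ to the terminal category $(W_1)^0$) is the identity, i.e. $p_m$ is an isomorphism of categories which identifies $W_m$ with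 the $m$-fold product of $W_1$. **Rectifications.** A *rectification* of a lax functor $W:\mathcal A\to\mathit{Cat}$ is a genuine functor $V:\mathcal A\to\mathit{Cat}$ together with a left lax transformation $E:V\to W$ (functors $E_a:V_a\to W_a$ with coherent natural transformations $W(f)E_a\Rightarrow E_bV(f)$) and a right lax transformation $J:W\to V$ (functors $J_a:W_a\to V_a$ with coherent natural transformations $J_bW(f)\Rightarrow V(f)J_a$) such that $J$ is left adjoint to $E$ (i.e. $J_a\dashv E_a$ for every $a$, and the transformations of $E$ and $J$ at each $f$ are mates under these adjunctions) and $W=EVJ$ as lax functors (i.e. $W(f)=E_bV(f)J_a$, the transformation $1\Rightarrow W(1_a)=E_aJ_a$ is the unit of $J_a\dashv E_a$, and $W(g)W(f)\Rightarrow W(gf)$ is $E_cV(g)\,\varepsilon_b\,V(f)J_a$ with $\varepsilon_b$ the counit of $J_b\dashv E_b$). Every lax functor has a rectification, by a construction of Street. **Segal's simplicial spaces.** A simplicial space $X:\Delta^{op}\to\mathit{Top}$ is a *partially realized multisimplicial set* if, up to isomorphism, it arises from a bisimplicial set $Y$ as $X_m=|Y_{m\,\_}|$. It is *Segal's simplicial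 space* if moreover for every $m\ge0$ the map $$p_m=\langle X(i_1),\dots,X(i_m)\rangle: X_m\to (X_1)^m$$ ($p_0$ being the unique map from $X_0$ to the one-point space $(X_1)^0$) is a homotopy equivalence. **Proposition 4.3.** If $W:\Delta^{op}\to\mathit{Cat}$ is Segal's lax functor and $V$ is a rectification of $W$, then $B\circ V:\Delta^{op}\to\mathit{Top}$ is Segal's simplicial space. -/

import Mathlib

open CategoryTheory Opposite
open scoped Bicategory Simplicial

universe v u w

noncomputable section

namespace SegalLax

/-! ### Simplicial spaces -/

/-- The arrow `i_{j+1} : [m] ⟶ [1]` of `Δᵒᵖ`: the opposite of the map `[1] ⟶ [m]` of `Δ` that sends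
`0 ↦ j` and `1 ↦ j + 1`. -/
def edge (m : ℕ) (j : Fin m) : op ⦋m⦌ ⟶ op ⦋1⦌ :=
  (SimplexCategory.mkOfSucc j).op

/-- The `m`-th power of a space, with the compactly generated product topology: the topology
generated by all continuous maps from compact Hausdorff spaces to the usual product.
For `m = 0` this is a point. -/
abbrev KPower (X : Type w) [TopologicalSpace X] (m : ℕ) : Type w :=
  Topology.WithGeneratedByTopology (fun K : CompHaus.{w} ↦ K) (Fin m → X)

/-- The map `p_m = ⟨i_1, …, i_m⟩ : X_m → (X_1)^m` of a simplicial space (as a function). -/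
def segalMap (X : SimplicialObject TopCat.{w}) (m : ℕ) :
    X.obj (op ⦋m⦌) → KPower (X.obj (op ⦋1⦌)) m :=
  fun x ↦ Topology.WithGeneratedByTopology.equiv.symm fun j ↦ X.map (edge m j) x

/-- A simplicial space is a partially realized multisimplicial set if it is the dimensionwise
geometric realization of a bisimplicial set, i.e. of a simplicial object in simplicial sets.
(A simplicial space which is the `p`-fold partial realization of a `(p+1)`-fold simplicial set is,
up to isomorphism, of this form: take the diagonal in the `p` realized variables if `p ≥ 1`, and a
constant simplicial set in each dimension if `p = 0`.) -/
def IsPartiallyRealized (X : SimplicialObject TopCat.{w}) : Prop :=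
  ∃ Y : SimplicialObject SSet.{w}, Nonempty (X ≅ Y ⋙ SSet.toTop)

/-- Segal's simplicial spaces: partially realized multisimplicial sets such that, for every
`m ≥ 0`, the map `p_m : X_m → (X_1)^m` is (continuous and) a homotopy equivalence. -/
structure IsSegalSpace (X : SimplicialObject TopCat.{w}) : Prop where
  isPartiallyRealized : IsPartiallyRealized X
  homotopyEquiv (m : ℕ) :
    ∃ e : ContinuousMap.HomotopyEquiv (X.obj (op ⦋m⦌)) (KPower (X.obj (op ⦋1⦌)) m),
      ⇑e = segalMap X m

/-- The classifying space functor `B = | | ∘ N`. -/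
def classifyingSpace : Cat.{v, u} ⥤ TopCat.{max u v} :=
  nerveFunctor ⋙ SSet.toTop

/-! ### Lax functors to `Cat` and their rectifications -/

/-- A lax functor `W : A → Cat` from an ordinary category `A`, with structure 2-cells
`W(g) ∘ W(f) ⇒ W(g ∘ f)` and `1 ⇒ W(1)`. -/
abbrev LaxToCat (A : Type) [Category.{0} A] :=
  LocallyDiscrete A ⥤ᴸ Cat.{v, u}

/-- A genuine functor, regarded as a lax functor with identity structure 2-cells. -/
abbrev asLax {A : Type} [Category.{0} A] (V : A ⥤ Cat.{v, u}) : LaxToCat.{v, u} A :=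
  V.toPseudofunctor'.toLax

/-- The functor `p_m = ⟨i_1, …, i_m⟩ : W_m ⥤ (W_1)^m` of a lax functor `W : Δᵒᵖ → Cat`. -/
def segalFunctor (W : LaxToCat.{v, u} SimplexCategoryᵒᵖ) (m : ℕ) :
    W.obj ⟨op ⦋m⦌⟩ ⟶ Cat.of (Fin m → W.obj ⟨op ⦋1⦌⟩) :=
  Functor.toCatHom (Functor.pi' fun j ↦ (W.map (edge m j).toLoc).toFunctor)

/-- A lax functor `W : Δᵒᵖ → Cat` is Segal's if every `p_m` identifies the category `W_m` with the
product category `(W_1)^m`, i.e. `W_m` is the `m`-fold product of `W_1` with projections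
`W(i_1), …, W(i_m)`. (For that choice of the product, `p_m` is the identity. A literal equality
between the type `W_m` and a function type `Fin m → W_1` would be a condition on the encoding of
tuples, and could not be expected even for `m = 1`.) -/
def IsSegalLax (W : LaxToCat.{v, u} SimplexCategoryᵒᵖ) : Prop :=
  ∀ m : ℕ, IsIso (segalFunctor W m)

/-- A rectification of a lax functor `W : A → Cat`: a genuine functor `V : A → Cat`, a left lax
transformation `E : V → W` (2-cells `W(f) ∘ E_a ⇒ E_b ∘ V(f)`), a right lax transformation
`J : W → V` (2-cells `J_b ∘ W(f) ⇒ V(f) ∘ J_a`), such that `J` is left adjoint to `E` (that is,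
`J_a ⊣ E_a` for every `a`, and the 2-cells of `E` and `J` are mates), and `W = EVJ`: the arrow
`W(f)` is `E_b ∘ V(f) ∘ J_a`, the 2-cell `1 ⇒ W(1)` is the unit of `J_a ⊣ E_a`, and the 2-cell
`W(g) ∘ W(f) ⇒ W(g ∘ f)` is induced by the counit of `J_b ⊣ E_b`.
(Recall that `≫` is written in diagrammatic order.) -/
structure Rectification {A : Type} [Category.{0} A] (W : LaxToCat.{v, u} A) where
  V : A ⥤ Cat.{v, u}
  E : Lax.LaxTrans (asLax V) W
  J : Lax.OplaxTrans W (asLax V)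
  adj (a : A) : Bicategory.Adjunction (J.app ⟨a⟩) (E.app ⟨a⟩)
  mate {a b : A} (f : a ⟶ b) :
    Bicategory.mateEquiv (adj a) (adj b) (J.naturality f.toLoc) = E.naturality f.toLoc
  map_eq {a b : A} (f : a ⟶ b) :
    W.map f.toLoc = J.app ⟨a⟩ ≫ V.map f ≫ E.app ⟨b⟩
  mapId_eq (a : A) :
    W.mapId ⟨a⟩ = (adj a).unit ≫
      eqToHom (show J.app ⟨a⟩ ≫ E.app ⟨a⟩ = W.map (𝟙 a : a ⟶ a).toLoc by
        rw [map_eq, V.map_id]; rfl)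
  mapComp_eq {a b c : A} (f : a ⟶ b) (g : b ⟶ c) :
    W.mapComp f.toLoc g.toLoc =
      eqToHom (show W.map f.toLoc ≫ W.map g.toLoc =
          (J.app ⟨a⟩ ≫ V.map f) ≫ (E.app ⟨b⟩ ≫ J.app ⟨b⟩) ≫ (V.map g ≫ E.app ⟨c⟩) by
        rw [map_eq, map_eq]; rfl) ≫
      (J.app ⟨a⟩ ≫ V.map f) ◁ ((adj b).counit ▷ (V.map g ≫ E.app ⟨c⟩)) ≫
      eqToHom (show (J.app ⟨a⟩ ≫ V.map f) ≫ 𝟙 (V.obj b) ≫ (V.map g ≫ E.app ⟨c⟩) =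
          W.map (f ≫ g).toLoc by
        rw [map_eq, V.map_comp]; rfl)

/-! ### Street's construction of a rectification

Every lax functor to `Cat` has a rectification; the following is Street's explicit one. -/

section Street

variable {A : Type} [Category.{0} A] (W : LaxToCat.{v, u} A)

/-- The functor `W(f)`. -/
abbrev laxMap {a b : A} (f : a ⟶ b) : W.obj ⟨a⟩ ⥤ W.obj ⟨b⟩ := (W.map f.toLoc).toFunctor

/-- The component `x ⟶ W(1) x` of the unit constraint. -/
def laxUnit {a : A} (x : W.obj ⟨a⟩) : x ⟶ (laxMap W (𝟙 a)).obj x :=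
  (W.mapId ⟨a⟩).toNatTrans.app x

/-- The component `W(g) (W(f) x) ⟶ W(h) x`, where `h = g ∘ f`, of the composition constraint. -/
def laxComp {a b c : A} (f : a ⟶ b) (g : b ⟶ c) (h : a ⟶ c) (e : f ≫ g = h) (x : W.obj ⟨a⟩) :
    (laxMap W g).obj ((laxMap W f).obj x) ⟶ (laxMap W h).obj x :=
  (W.mapComp f.toLoc g.toLoc).toNatTrans.app x ≫ eqToHom (by subst e; rfl)

lemma laxComp_rfl {a b c : A} (f : a ⟶ b) (g : b ⟶ c) (x : W.obj ⟨a⟩) :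
    laxComp W f g (f ≫ g) rfl x = (W.mapComp f.toLoc g.toLoc).toNatTrans.app x := by
  exact Category.comp_id _

lemma map₂_app {a b : LocallyDiscrete A} {f g : a ⟶ b} (η : f ⟶ g) (x : W.obj a) :
    (W.map₂ η).toNatTrans.app x = eqToHom (by rw [LocallyDiscrete.eq_of_hom η]) := by
  obtain rfl := LocallyDiscrete.eq_of_hom η
  rw [Subsingleton.elim η (𝟙 f), W.map₂_id]
  simp

lemma laxUnit_naturality {a : A} {x y : W.obj ⟨a⟩} (φ : x ⟶ y) :
    φ ≫ laxUnit W y = laxUnit W x ≫ (laxMap W (𝟙 a)).map φ :=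
  (W.mapId ⟨a⟩).toNatTrans.naturality φ

lemma laxUnit_naturality_assoc {a : A} {x y z : W.obj ⟨a⟩} (φ : x ⟶ y)
    (k : (laxMap W (𝟙 a)).obj y ⟶ z) :
    φ ≫ laxUnit W y ≫ k = laxUnit W x ≫ (laxMap W (𝟙 a)).map φ ≫ k := by
  rw [← Category.assoc, laxUnit_naturality, Category.assoc]

lemma laxComp_naturality {a b c : A} (f : a ⟶ b) (g : b ⟶ c) (h : a ⟶ c) (e : f ≫ g = h)
    {x y : W.obj ⟨a⟩} (φ : x ⟶ y) :
    (laxMap W g).map ((laxMap W f).map φ) ≫ laxComp W f g h e y =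
      laxComp W f g h e x ≫ (laxMap W h).map φ := by
  subst e
  rw [laxComp_rfl, laxComp_rfl]
  exact (W.mapComp f.toLoc g.toLoc).toNatTrans.naturality φ

lemma laxComp_naturality_assoc {a b c : A} (f : a ⟶ b) (g : b ⟶ c) (h : a ⟶ c) (e : f ≫ g = h)
    {x y : W.obj ⟨a⟩} (φ : x ⟶ y) {z : W.obj ⟨c⟩} (k : (laxMap W h).obj y ⟶ z) :
    (laxMap W g).map ((laxMap W f).map φ) ≫ laxComp W f g h e y ≫ k =
      laxComp W f g h e x ≫ (laxMap W h).map φ ≫ k := by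
  rw [← Category.assoc, laxComp_naturality, Category.assoc]

lemma laxComp_assoc {a b c d : A} (f : a ⟶ b) (g : b ⟶ c) (h : c ⟶ d) (fg : a ⟶ c) (gh : b ⟶ d)
    (fgh : a ⟶ d) (e₁ : f ≫ g = fg) (e₂ : g ≫ h = gh) (e₃ : fg ≫ h = fgh) (e₄ : f ≫ gh = fgh)
    (x : W.obj ⟨a⟩) :
    (laxMap W h).map (laxComp W f g fg e₁ x) ≫ laxComp W fg h fgh e₃ x =
      laxComp W g h gh e₂ ((laxMap W f).obj x) ≫ laxComp W f gh fgh e₄ x := by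
  subst e₁ e₂ e₄
  have := congrArg (fun t ↦ t.toNatTrans.app x) (W.map₂_associator f.toLoc g.toLoc h.toLoc)
  dsimp only [Cat.Hom₂.comp_app] at this
  rw [map₂_app] at this
  rw [laxComp_rfl, laxComp_rfl, laxComp_rfl]
  unfold laxComp
  refine Eq.trans ?_ (this.trans (Category.id_comp _))
  rfl

lemma laxUnit_comp {a b : A} (f g : a ⟶ b) (e : 𝟙 a ≫ f = g) (x : W.obj ⟨a⟩) :
    (laxMap W f).map (laxUnit W x) ≫ laxComp W (𝟙 a) f g e x =
      eqToHom (by rw [← e, Category.id_comp]) := by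
  have h := congrArg (fun t ↦ t.toNatTrans.app x) (W.map₂_leftUnitor f.toLoc)
  dsimp only [Cat.Hom₂.comp_app] at h
  rw [map₂_app] at h
  have h' := (h.trans (Category.id_comp _)).symm
  unfold laxComp
  rw [← Category.assoc]
  exact (congrArg (fun t ↦ t ≫ eqToHom (by subst e; rfl)) h').trans (by simp)

lemma laxComp_unit {a b : A} (f g : a ⟶ b) (e : f ≫ 𝟙 b = g) (x : W.obj ⟨a⟩) :
    laxUnit W ((laxMap W f).obj x) ≫ laxComp W f (𝟙 b) g e x =
      eqToHom (by rw [← e, Category.comp_id]) := by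
  have h := congrArg (fun t ↦ t.toNatTrans.app x) (W.map₂_rightUnitor f.toLoc)
  dsimp only [Cat.Hom₂.comp_app] at h
  rw [map₂_app] at h
  have h' := (h.trans (Category.id_comp _)).symm
  unfold laxComp
  rw [← Category.assoc]
  exact (congrArg (fun t ↦ t ≫ eqToHom (by subst e; rfl)) h').trans (by simp)

lemma laxComp_unit_assoc {a b : A} (f g : a ⟶ b) (e : f ≫ 𝟙 b = g) (x : W.obj ⟨a⟩)
    {z : W.obj ⟨b⟩} (k : (laxMap W g).obj x ⟶ z) :
    laxUnit W ((laxMap W f).obj x) ≫ laxComp W f (𝟙 b) g e x ≫ k =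
      eqToHom (by rw [← e, Category.comp_id]) ≫ k := by
  rw [← Category.assoc, laxComp_unit]

/-- The objects of the category `V(a)` of Street's rectification: pairs of an arrow `b ⟶ a` of `A`
and an object of `W(b)`. -/
structure StreetObj (a : A) : Type u where
  base : A
  arrow : base ⟶ a
  fiber : W.obj ⟨base⟩

variable {W}

lemma StreetObj.ext' {a b : A} {f f' : b ⟶ a} {x : W.obj ⟨b⟩} (h : f = f') :
    (⟨b, f, x⟩ : StreetObj W a) = ⟨b, f', x⟩ := by rw [h]

/-- The morphisms `(f : b ⟶ a, x) ⟶ (g : c ⟶ a, y)` of `V(a)`: arrows `t : c ⟶ b` with `f ∘ t = g`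
together with a morphism `x ⟶ W(t) y`. -/
structure StreetHom {a : A} (X Y : StreetObj W a) : Type v where
  arrow : Y.base ⟶ X.base
  w : arrow ≫ X.arrow = Y.arrow
  fiber : X.fiber ⟶ (laxMap W arrow).obj Y.fiber

lemma StreetHom.ext' {a : A} {X Y : StreetObj W a} {s t : StreetHom X Y} (h : s.arrow = t.arrow)
    (h' : s.fiber ≫ eqToHom (by rw [h]) = t.fiber) : s = t := by
  obtain ⟨s, _, σ⟩ := s
  obtain ⟨t, _, τ⟩ := t
  obtain rfl : s = t := h
  simpa using h'

lemma laxComp_eq {a b c : A} (f : a ⟶ b) (g : b ⟶ c) (h h' : a ⟶ c) (e : f ≫ g = h) (e' : h = h')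
    (x : W.obj ⟨a⟩) :
    laxComp W f g h e x ≫ eqToHom (by rw [e']) = laxComp W f g h' (e.trans e') x := by
  subst e'; simp

lemma laxComp_congr {a b c : A} (f f' : a ⟶ b) (g : b ⟶ c) (h h' : a ⟶ c) (e : f ≫ g = h)
    (e₁ : f = f') (e₂ : h = h') (x : W.obj ⟨a⟩) :
    laxComp W f g h e x ≫ eqToHom (by rw [e₂]) =
      (laxMap W g).map (eqToHom (by rw [e₁])) ≫
        laxComp W f' g h' (by rw [← e₁, ← e₂, e]) x := by
  subst e₁ e₂; simp

instance {a : A} : Category.{v} (StreetObj W a) where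
  Hom := StreetHom
  id X := ⟨𝟙 _, Category.id_comp _, laxUnit W _⟩
  comp {X Y Z} s t := ⟨t.arrow ≫ s.arrow, by rw [Category.assoc, s.w, t.w],
    s.fiber ≫ (laxMap W s.arrow).map t.fiber ≫ laxComp W t.arrow s.arrow _ rfl Z.fiber⟩
  id_comp s := StreetHom.ext' (Category.comp_id _) (by
    simp only [Category.assoc, laxComp_eq _ _ _ _ rfl (Category.comp_id _)]
    rw [← laxUnit_naturality_assoc, laxComp_unit, eqToHom_refl, Category.comp_id])
  comp_id s := StreetHom.ext' (Category.id_comp _) (by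
    simp only [Category.assoc, laxComp_eq _ _ _ _ rfl (Category.id_comp _)]
    rw [laxUnit_comp, eqToHom_refl, Category.comp_id])
  assoc s t r := StreetHom.ext' (Category.assoc _ _ _).symm (by
    simp only [Category.assoc, laxComp_eq _ _ _ _ rfl (Category.assoc _ _ _).symm, CategoryTheory.Functor.map_comp]
    rw [laxComp_assoc W _ _ _ _ _ _ rfl rfl (by simp) (by simp), ← laxComp_naturality_assoc])

lemma street_ext {a : A} {X Y : StreetObj W a} {s t : X ⟶ Y} (h : s.arrow = t.arrow)
    (h' : s.fiber ≫ eqToHom (by rw [h]) = t.fiber) : s = t :=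
  StreetHom.ext' h h'

@[simp] lemma street_id_arrow {a : A} (X : StreetObj W a) : StreetHom.arrow (𝟙 X) = 𝟙 _ := rfl
@[simp] lemma street_id_fiber {a : A} (X : StreetObj W a) :
  StreetHom.fiber (𝟙 X) = laxUnit W _ := rfl
@[simp] lemma street_comp_arrow {a : A} {X Y Z : StreetObj W a} (s : X ⟶ Y) (t : Y ⟶ Z) :
  StreetHom.arrow (s ≫ t) = t.arrow ≫ s.arrow := rfl
@[simp] lemma street_comp_fiber {a : A} {X Y Z : StreetObj W a} (s : X ⟶ Y) (t : Y ⟶ Z) :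
  StreetHom.fiber (s ≫ t) = s.fiber ≫ (laxMap W s.arrow).map t.fiber ≫
    laxComp W t.arrow s.arrow _ rfl Z.fiber := rfl

/-- The functor `V(h)`, given by composition with `h` in the first component. -/
def streetMap {a b : A} (h : a ⟶ b) : StreetObj W a ⥤ StreetObj W b where
  obj X := ⟨X.base, X.arrow ≫ h, X.fiber⟩
  map s := ⟨s.arrow, by rw [← Category.assoc, s.w], s.fiber⟩

lemma StreetHom.hext {a b : A} {f f' : b ⟶ a} {x : W.obj ⟨b⟩} {c : A} {g g' : c ⟶ a}
    {y : W.obj ⟨c⟩} (hf : f = f') (hg : g = g') (t : c ⟶ b) (w : t ≫ f = g) (w' : t ≫ f' = g')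
    (φ : x ⟶ (laxMap W t).obj y) :
    HEq (⟨t, w, φ⟩ : StreetHom (⟨b, f, x⟩ : StreetObj W a) ⟨c, g, y⟩)
      (⟨t, w', φ⟩ : StreetHom (⟨b, f', x⟩ : StreetObj W a) ⟨c, g', y⟩) := by
  subst hf hg; rfl

variable (W) in
/-- Street's functor `V`. -/
def street : A ⥤ Cat.{v, u} where
  obj a := Cat.of (StreetObj W a)
  map h := (streetMap h).toCatHom
  map_id a := by
    apply Cat.Hom.ext
    refine Functor.hext (fun X ↦ ?_) (fun X Y s ↦ ?_)
    · exact StreetObj.ext' (Category.comp_id _)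
    · exact StreetHom.hext (Category.comp_id _) (Category.comp_id _) _ _ s.w _
  map_comp f g := by
    apply Cat.Hom.ext
    refine Functor.hext (fun X ↦ ?_) (fun X Y s ↦ ?_)
    · exact StreetObj.ext' (Category.assoc _ _ _).symm
    · exact StreetHom.hext (Category.assoc _ _ _).symm (Category.assoc _ _ _).symm _ _ _ _

/-- The functor `E_a : V(a) ⥤ W(a)`. -/
def streetE (a : A) : StreetObj W a ⥤ W.obj ⟨a⟩ where
  obj X := (laxMap W X.arrow).obj X.fiber
  map {X Y} s := (laxMap W X.arrow).map s.fiber ≫ laxComp W s.arrow X.arrow _ s.w Y.fiber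
  map_id X := (laxUnit_comp W _ _ _ _).trans (eqToHom_refl _ _)
  map_comp {X Y Z} s t := by
    have h := laxComp_assoc W t.arrow s.arrow X.arrow _ Y.arrow Z.arrow rfl s.w
      (by rw [Category.assoc, s.w, t.w]) t.w Z.fiber
    rw [street_comp_fiber, CategoryTheory.Functor.map_comp, CategoryTheory.Functor.map_comp, Category.assoc, Category.assoc,
      Category.assoc]
    refine congrArg _ ((congrArg _ h).trans ?_)
    rw [← laxComp_naturality_assoc]

/-- The functor `J_a : W(a) ⥤ V(a)`. -/
def streetJ (a : A) : W.obj ⟨a⟩ ⥤ StreetObj W a where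
  obj x := ⟨a, 𝟙 a, x⟩
  map {x y} φ := ⟨𝟙 a, Category.comp_id _, φ ≫ laxUnit W y⟩
  map_id x := street_ext rfl (by simp)
  map_comp {x y z} φ ψ := by
    refine street_ext (Category.comp_id (𝟙 a)).symm ?_
    rw [street_comp_fiber, CategoryTheory.Functor.map_comp]
    simp only [Category.assoc]
    rw [laxUnit_comp, laxUnit_naturality_assoc]

lemma laxUnit_unit {a : A} (x : W.obj ⟨a⟩) :
    ((laxUnit W x ≫ laxUnit W ((laxMap W (𝟙 a)).obj x)) ≫ (laxMap W (𝟙 a)).map (𝟙 _) ≫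
      laxComp W (𝟙 a) (𝟙 a) (𝟙 a ≫ 𝟙 a) rfl x) ≫ eqToHom (by rw [Category.comp_id]) =
        laxUnit W x := by
  rw [CategoryTheory.Functor.map_id]
  simp only [Category.id_comp, Category.assoc]
  rw [laxComp_unit_assoc, eqToHom_trans, eqToHom_refl, Category.comp_id]

variable (W) in
/-- The unit of `J_a ⊣ E_a`. -/
def streetUnit (a : A) : 𝟭 (W.obj ⟨a⟩) ⟶ streetJ (W := W) a ⋙ streetE a where
  app x := laxUnit W x
  naturality x y φ := by
    have key : φ ≫ laxUnit W y = laxUnit W x ≫ (laxMap W (𝟙 a)).map (φ ≫ laxUnit W y) ≫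
        laxComp W (𝟙 a) (𝟙 a) (𝟙 a) (Category.comp_id _) y := by
      rw [CategoryTheory.Functor.map_comp, Category.assoc, laxUnit_comp, eqToHom_refl,
        Category.comp_id, laxUnit_naturality]
    exact key

variable (W) in
/-- The counit of `J_a ⊣ E_a`. -/
def streetCounit (a : A) : streetE (W := W) a ⋙ streetJ a ⟶ 𝟭 (StreetObj W a) where
  app X := (⟨X.arrow, Category.comp_id _, 𝟙 _⟩ :
    StreetHom (⟨a, 𝟙 a, (laxMap W X.arrow).obj X.fiber⟩ : StreetObj W a) X)
  naturality X Y s := by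
    have key : ((((laxMap W X.arrow).map s.fiber ≫ laxComp W s.arrow X.arrow _ s.w Y.fiber) ≫
          laxUnit W ((laxMap W Y.arrow).obj Y.fiber)) ≫
        (laxMap W (𝟙 a)).map (𝟙 ((laxMap W Y.arrow).obj Y.fiber)) ≫
          laxComp W Y.arrow (𝟙 a) (Y.arrow ≫ 𝟙 a) rfl Y.fiber) ≫
        eqToHom (by rw [s.w, Category.comp_id]) =
      𝟙 ((laxMap W X.arrow).obj X.fiber) ≫ (laxMap W X.arrow).map s.fiber ≫
        laxComp W s.arrow X.arrow (s.arrow ≫ X.arrow) rfl Y.fiber := by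
      rw [CategoryTheory.Functor.map_id, Category.id_comp, Category.id_comp,
        Category.assoc, Category.assoc, Category.assoc, laxComp_unit_assoc, eqToHom_trans,
        laxComp_eq _ _ _ _ s.w s.w.symm]
    exact street_ext ((Category.comp_id _).trans s.w.symm) key

/-- The adjunction `J_a ⊣ E_a`. -/
def streetAdj (a : A) : streetJ (W := W) a ⊣ streetE a where
  unit := streetUnit W a
  counit := streetCounit W a
  left_triangle_components x := by
    exact street_ext (Category.comp_id _) (laxUnit_unit x)
  right_triangle_components X := by
    have key : laxUnit W ((laxMap W X.arrow).obj X.fiber) ≫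
      (laxMap W (𝟙 a)).map (𝟙 ((laxMap W X.arrow).obj X.fiber)) ≫
        laxComp W X.arrow (𝟙 a) X.arrow (Category.comp_id _) X.fiber =
          𝟙 ((laxMap W X.arrow).obj X.fiber) := by
      rw [CategoryTheory.Functor.map_id, Category.id_comp, laxComp_unit, eqToHom_refl]
    exact key

lemma street_eqToHom {a b : A} {f f' : b ⟶ a} {x : W.obj ⟨b⟩} (h : f = f')
    (h' : (⟨b, f, x⟩ : StreetObj W a) = ⟨b, f', x⟩) :
    eqToHom h' = (⟨𝟙 b, by rw [Category.id_comp, h], laxUnit W x⟩ :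
      StreetHom (⟨b, f, x⟩ : StreetObj W a) ⟨b, f', x⟩) := by
  subst h; rfl

lemma asLax_mapId_app (V : A ⥤ Cat.{v, u}) (a : A) (x : V.obj a) :
    ((asLax V).mapId ⟨a⟩).toNatTrans.app x =
      eqToHom (show x = (V.map (𝟙 a)).toFunctor.obj x by rw [V.map_id]; rfl) := by
  refine (Cat.eqToHom_app _ _ ?_ x)
  exact (V.map_id a).symm

lemma asLax_mapComp_app (V : A ⥤ Cat.{v, u}) {a b c : A} (f : a ⟶ b) (g : b ⟶ c) (x : V.obj a) :
    ((asLax V).mapComp f.toLoc g.toLoc).toNatTrans.app x =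
      eqToHom (show (V.map g).toFunctor.obj ((V.map f).toFunctor.obj x) =
        (V.map (f ≫ g)).toFunctor.obj x by rw [V.map_comp]; rfl) := by
  refine (Cat.eqToHom_app _ _ ?_ x)
  exact (V.map_comp f g).symm

/-- Compatibility with 2-cells of the source is automatic. -/
lemma lax_nn {F G : LaxToCat.{v, u} A} {a b : LocallyDiscrete A} (p : F.obj a ⟶ G.obj a)
    (q : F.obj b ⟶ G.obj b) (nat : ∀ f : a ⟶ b, p ≫ G.map f ⟶ F.map f ≫ q) {f g : a ⟶ b}
    (η : f ⟶ g) : nat f ≫ F.map₂ η ▷ q = p ◁ G.map₂ η ≫ nat g := by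
  obtain rfl := LocallyDiscrete.eq_of_hom η
  rw [Subsingleton.elim η (𝟙 f)]
  simp

lemma oplax_nn {F G : LaxToCat.{v, u} A} {a b : LocallyDiscrete A} (p : F.obj a ⟶ G.obj a)
    (q : F.obj b ⟶ G.obj b) (nat : ∀ f : a ⟶ b, F.map f ≫ q ⟶ p ≫ G.map f) {f g : a ⟶ b}
    (η : f ⟶ g) : F.map₂ η ▷ q ≫ nat g = nat f ≫ p ◁ G.map₂ η := by
  obtain rfl := LocallyDiscrete.eq_of_hom η
  rw [Subsingleton.elim η (𝟙 f)]
  simp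

variable (W) in
/-- The 2-cells of `E`. -/
def streetENat {a b : A} (f : a ⟶ b) :
    streetE (W := W) a ⋙ laxMap W f ⟶ streetMap f ⋙ streetE b where
  app X := laxComp W X.arrow f _ rfl X.fiber
  naturality X Y s := by
    change (laxMap W f).map ((laxMap W X.arrow).map s.fiber ≫
        laxComp W s.arrow X.arrow _ s.w Y.fiber) ≫ laxComp W Y.arrow f _ rfl Y.fiber =
      laxComp W X.arrow f _ rfl X.fiber ≫ (laxMap W (X.arrow ≫ f)).map s.fiber ≫
        laxComp W s.arrow (X.arrow ≫ f) (Y.arrow ≫ f)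
          (by rw [← Category.assoc, s.w]) Y.fiber
    rw [CategoryTheory.Functor.map_comp, Category.assoc, ← laxComp_naturality_assoc,
      laxComp_assoc W _ _ _ _ _ _ s.w rfl rfl]

variable (W) in
/-- The 2-cells of `J`. -/
def streetJNat {a b : A} (f : a ⟶ b) :
    laxMap W f ⋙ streetJ (W := W) b ⟶ streetJ a ⋙ streetMap f where
  app x := (⟨f, (Category.comp_id _).trans (Category.id_comp _).symm, 𝟙 _⟩ :
    StreetHom (⟨b, 𝟙 b, (laxMap W f).obj x⟩ : StreetObj W b)
      (⟨a, 𝟙 a ≫ f, x⟩ : StreetObj W b))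
  naturality x y φ := by
    have key : (((laxMap W f).map φ ≫ laxUnit W ((laxMap W f).obj y)) ≫
        (laxMap W (𝟙 b)).map (𝟙 ((laxMap W f).obj y)) ≫
          laxComp W f (𝟙 b) (f ≫ 𝟙 b) rfl y) ≫
            eqToHom (by rw [Category.comp_id, Category.id_comp]) =
      𝟙 ((laxMap W f).obj x) ≫ (laxMap W f).map (φ ≫ laxUnit W y) ≫
        laxComp W (𝟙 a) f (𝟙 a ≫ f) rfl y := by
      rw [CategoryTheory.Functor.map_id, CategoryTheory.Functor.map_comp]
      simp only [Category.id_comp, Category.assoc]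
      rw [laxComp_unit_assoc, laxUnit_comp, eqToHom_trans]
    exact street_ext ((Category.comp_id _).trans (Category.id_comp _).symm) key

lemma streetE_id {a : A} (X : StreetObj W a)
    (h : X = ⟨X.base, X.arrow ≫ 𝟙 a, X.fiber⟩) :
    laxUnit W ((laxMap W X.arrow).obj X.fiber) ≫
        laxComp W X.arrow (𝟙 a) (X.arrow ≫ 𝟙 a) rfl X.fiber =
      (streetE a).map (eqToHom h) := by
  rw [laxComp_unit, eqToHom_map]
  rfl

lemma streetE_comp {a b c : A} (f : a ⟶ b) (g : b ⟶ c) (X : StreetObj W a)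
    (h : (⟨X.base, (X.arrow ≫ f) ≫ g, X.fiber⟩ : StreetObj W c) =
      ⟨X.base, X.arrow ≫ f ≫ g, X.fiber⟩) :
    laxComp W f g _ rfl ((laxMap W X.arrow).obj X.fiber) ≫
        laxComp W X.arrow (f ≫ g) (X.arrow ≫ f ≫ g) rfl X.fiber =
      (laxMap W g).map (laxComp W X.arrow f _ rfl X.fiber) ≫
        laxComp W (X.arrow ≫ f) g ((X.arrow ≫ f) ≫ g) rfl X.fiber ≫
        (streetE c).map (eqToHom h) := by
  rw [eqToHom_map]
  refine (laxComp_assoc W X.arrow f g _ _ _ rfl rfl (Category.assoc _ _ _) rfl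
    X.fiber).symm.trans ?_
  exact congrArg _ (laxComp_eq _ _ _ _ rfl (Category.assoc _ _ _) _).symm

lemma streetJ_id {a : A} (x : W.obj ⟨a⟩)
    (h : (⟨a, 𝟙 a, x⟩ : StreetObj W a) = ⟨a, 𝟙 a ≫ 𝟙 a, x⟩) :
    (streetJ a).map (laxUnit W x) ≫ (streetJNat W (𝟙 a)).app x = eqToHom h := by
  rw [street_eqToHom (Category.comp_id _).symm]
  exact street_ext (Category.comp_id _) (laxUnit_unit x)

lemma streetJ_comp {a b c : A} (f : a ⟶ b) (g : b ⟶ c) (x : W.obj ⟨a⟩)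
    (h : (⟨a, (𝟙 a ≫ f) ≫ g, x⟩ : StreetObj W c) = ⟨a, 𝟙 a ≫ f ≫ g, x⟩) :
    (streetJ c).map (laxComp W f g _ rfl x) ≫ (streetJNat W (f ≫ g)).app x =
      (streetJNat W g).app ((laxMap W f).obj x) ≫
        (streetMap g).map ((streetJNat W f).app x) ≫ eqToHom h := by
  have key : ((laxComp W f g _ rfl x ≫ laxUnit W ((laxMap W (f ≫ g)).obj x)) ≫
      (laxMap W (𝟙 c)).map (𝟙 _) ≫
      laxComp W (f ≫ g) (𝟙 c) ((f ≫ g) ≫ 𝟙 c) rfl x) ≫ eqToHom (by simp) =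
      𝟙 _ ≫ (laxMap W g).map (𝟙 _ ≫ (laxMap W f).map (laxUnit W x) ≫
        laxComp W (𝟙 a) f (𝟙 a ≫ f) rfl x) ≫ laxComp W (𝟙 a ≫ f) g ((𝟙 a ≫ f) ≫ g) rfl x := by
    rw [CategoryTheory.Functor.map_id, laxUnit_comp]
    simp only [Category.id_comp, Category.assoc]
    rw [laxComp_unit_assoc, eqToHom_trans]
    exact laxComp_congr f (𝟙 a ≫ f) g _ _ rfl (by simp) (by simp) x
  have h₂ : (f ≫ g) ≫ 𝟙 c = (𝟙 a ≫ f) ≫ g := by simp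
  exact (street_ext h₂ key).trans
    (congrArg (fun t ↦ (streetJNat W g).app ((laxMap W f).obj x) ≫
      (streetMap g).map ((streetJNat W f).app x) ≫ t) (street_eqToHom (Category.assoc _ _ _) h).symm)

variable (W) in
/-- The left lax transformation `E : V → W`. -/
def streetLaxTrans : Lax.LaxTrans (asLax (street W)) W where
  app a := (streetE a.as).toCatHom
  naturality f := (streetENat W f.as).toCatHom₂
  naturality_naturality {a b f g} η :=
    lax_nn (F := asLax (street W)) (G := W) (a := a) (b := b) (streetE a.as).toCatHom
      (streetE b.as).toCatHom (fun f ↦ (streetENat W f.as).toCatHom₂) η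
  naturality_id a := by
    apply Cat.Hom₂.ext
    apply NatTrans.ext
    funext X
    refine (streetE_id (W := W) (a := a.as) X ?_).trans ?_
    · exact StreetObj.ext' (Category.comp_id _).symm
    refine Eq.trans ?_ ((Category.id_comp _).trans (Category.id_comp _)).symm
    exact congrArg (streetE a.as).map (asLax_mapId_app (street W) a.as X).symm
  naturality_comp {a b c} f g := by
    apply Cat.Hom₂.ext
    apply NatTrans.ext
    funext X
    have h : (⟨StreetObj.base X, (X.arrow ≫ f.as) ≫ g.as, X.fiber⟩ : StreetObj W c.as) =
      ⟨X.base, X.arrow ≫ f.as ≫ g.as, X.fiber⟩ := StreetObj.ext' (Category.assoc _ _ _)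
    have key := streetE_comp (W := W) f.as g.as X h
    rw [laxComp_rfl] at key
    refine key.trans (Eq.trans ?_ (Category.id_comp _).symm)
    refine congrArg _ (Eq.trans ?_ (Category.id_comp _).symm)
    refine congrArg _ (Eq.trans ?_ (Category.id_comp _).symm)
    exact congrArg (streetE c.as).map (asLax_mapComp_app (street W) f.as g.as X).symm

variable (W) in
/-- The right lax transformation `J : W → V`. -/
def streetOplaxTrans : Lax.OplaxTrans W (asLax (street W)) where
  app a := (streetJ a.as).toCatHom
  naturality f := (streetJNat W f.as).toCatHom₂
  naturality_naturality {a b f g} η :=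
    oplax_nn (G := asLax (street W)) (F := W) (a := a) (b := b) (streetJ a.as).toCatHom
      (streetJ b.as).toCatHom (fun f ↦ (streetJNat W f.as).toCatHom₂) η
  naturality_id a := by
    apply Cat.Hom₂.ext
    apply NatTrans.ext
    funext x
    refine (streetJ_id (W := W) (a := a.as) x ?_).trans ?_
    · exact StreetObj.ext' (Category.comp_id _).symm
    refine Eq.trans ?_ ((Category.id_comp _).trans (Category.id_comp _)).symm
    exact (asLax_mapId_app (street W) a.as _).symm
  naturality_comp {a b c} f g := by
    apply Cat.Hom₂.ext
    apply NatTrans.ext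
    funext x
    have h : (⟨a.as, (𝟙 a.as ≫ f.as) ≫ g.as, x⟩ : StreetObj W c.as) =
      ⟨a.as, 𝟙 a.as ≫ f.as ≫ g.as, x⟩ := StreetObj.ext' (Category.assoc _ _ _)
    have key := streetJ_comp (W := W) f.as g.as x h
    rw [laxComp_rfl] at key
    refine key.trans (Eq.trans ?_ (Category.id_comp _).symm)
    refine congrArg _ (Eq.trans ?_ (Category.id_comp _).symm)
    refine congrArg _ (Eq.trans ?_ (Category.id_comp _).symm)
    exact (asLax_mapComp_app (street W) f.as g.as ((streetJ a.as).obj x)).symm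

lemma laxComp_congr' {a b c : A} (f f' : a ⟶ b) (g g' : b ⟶ c) (h h' : a ⟶ c) (e : f ≫ g = h)
    (e₁ : f = f') (e₂ : g = g') (e₃ : h = h') (x : W.obj ⟨a⟩) :
    laxComp W f g h e x = eqToHom (by rw [e₁, e₂]) ≫
      ((laxMap W g').map (𝟙 _) ≫ laxComp W f' g' h' (by rw [← e₁, ← e₂, ← e₃, e]) x) ≫
        eqToHom (by rw [e₃]) := by
  subst e₁ e₂ e₃; simp

lemma street_map_eq {a b : A} (f : a ⟶ b) :
    laxMap W f = streetJ a ⋙ streetMap f ⋙ streetE b := by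
  have h : ∀ (g : a ⟶ b) (e : 𝟙 a ≫ g = g) (_ : f = g) {x y : W.obj ⟨a⟩} (φ : x ⟶ y),
      HEq ((laxMap W f).map φ)
        ((laxMap W g).map (φ ≫ laxUnit W y) ≫ laxComp W (𝟙 a) g g e y) := by
    intro g e hg x y φ
    subst hg
    rw [CategoryTheory.Functor.map_comp, Category.assoc, laxUnit_comp, eqToHom_refl,
      Category.comp_id]
  have hf : f = 𝟙 a ≫ f := (Category.id_comp f).symm
  refine Functor.hext (fun x ↦ ?_) (fun x y φ ↦ ?_)
  · exact congrArg (fun g ↦ (laxMap W g).obj x) hf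
  · exact h (𝟙 a ≫ f) (Category.id_comp _) hf φ

lemma street_mate {a b : A} (f : a ⟶ b) (X : StreetObj W a) :
    laxUnit W ((laxMap W f).obj ((laxMap W X.arrow).obj X.fiber)) ≫
      (streetE b).map ((streetJNat W f).app ((laxMap W X.arrow).obj X.fiber)) ≫
        (streetE b).map ((streetMap f).map ((streetCounit W a).app X)) =
      laxComp W X.arrow f _ rfl X.fiber := by
  have key : laxUnit W ((laxMap W f).obj ((laxMap W X.arrow).obj X.fiber)) ≫
      ((laxMap W (𝟙 b)).map (𝟙 _) ≫ laxComp W f (𝟙 b) (𝟙 a ≫ f) (by simp)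
        ((laxMap W X.arrow).obj X.fiber)) ≫
      ((laxMap W (𝟙 a ≫ f)).map (𝟙 _) ≫
        laxComp W X.arrow (𝟙 a ≫ f) (X.arrow ≫ f) (by simp) X.fiber) =
      laxComp W X.arrow f _ rfl X.fiber := by
    rw [laxComp_congr' X.arrow X.arrow f (𝟙 a ≫ f) _ _ rfl rfl (by simp) rfl]
    simp only [CategoryTheory.Functor.map_id, Category.id_comp, eqToHom_refl, Category.comp_id]
    rw [laxComp_unit_assoc]
  exact key

lemma eqToHom_app' {C D : Cat.{v, u}} {F G : C ⟶ D} (h : F = G) (x : C)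
    (h' : F.toFunctor.obj x = G.toFunctor.obj x) :
    eqToHom h' = (eqToHom h).toNatTrans.app x := by
  subst h; rfl

variable (W) in
/-- Street's rectification of a lax functor to `Cat`. -/
def streetRectification : Rectification W where
  V := street W
  E := streetLaxTrans W
  J := streetOplaxTrans W
  adj a := (streetAdj (W := W) a).toCat
  mate {a b} f := by
    apply Cat.Hom₂.ext
    apply NatTrans.ext
    funext X
    refine Eq.trans ?_ (street_mate (W := W) f X)
    have key : ∀ {C : Cat.{v, u}} {p q r s : C} (α : p ⟶ q) (β : q ⟶ r) (γ : r ⟶ s),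
        (𝟙 p ≫ (𝟙 p ≫ α ≫ 𝟙 q ≫ β) ≫ 𝟙 r) ≫ 𝟙 r ≫ γ ≫ 𝟙 s = α ≫ β ≫ γ := by
      intros; simp
    exact key (C := W.obj ⟨b⟩) _ _ _
  map_eq f := Cat.Hom.ext (street_map_eq f)
  mapId_eq a := by
    apply Cat.Hom₂.ext
    apply NatTrans.ext
    funext x
    refine (Category.comp_id (laxUnit W x)).symm.trans ?_
    refine congrArg (fun t ↦ laxUnit W x ≫ t) ?_
    exact eqToHom_app' (C := W.obj ⟨a⟩) (D := W.obj ⟨a⟩)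
      (F := (streetOplaxTrans W).app ⟨a⟩ ≫ (streetLaxTrans W).app ⟨a⟩)
      (G := W.map (𝟙 a : a ⟶ a).toLoc) _ x rfl
  mapComp_eq {a b c} f g := by
    apply Cat.Hom₂.ext
    apply NatTrans.ext
    funext x
    rw [← laxComp_rfl]
    refine (laxComp_congr' f (𝟙 a ≫ f) g (𝟙 b ≫ g) _ ((𝟙 a ≫ f) ≫ g) rfl (by simp) (by simp)
      (by simp) x).trans ?_
    refine congrArg₂ (fun s t ↦ s ≫ t) ?_ (congrArg₂ (fun s t ↦ s ≫ t) rfl ?_)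
    · exact eqToHom_app' (C := W.obj ⟨a⟩) (D := W.obj ⟨c⟩) (F := W.map f.toLoc ≫ W.map g.toLoc)
        (G := ((streetOplaxTrans W).app ⟨a⟩ ≫ (street W).map f) ≫
          ((streetLaxTrans W).app ⟨b⟩ ≫ (streetOplaxTrans W).app ⟨b⟩) ≫
          ((street W).map g ≫ (streetLaxTrans W).app ⟨c⟩)) _ x _
    · exact eqToHom_app' (C := W.obj ⟨a⟩) (D := W.obj ⟨c⟩)
        (F := ((streetOplaxTrans W).app ⟨a⟩ ≫ (street W).map f) ≫ 𝟙 ((street W).obj b) ≫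
          ((street W).map g ≫ (streetLaxTrans W).app ⟨c⟩))
        (G := W.map (f ≫ g).toLoc) _ x _

end Street

end SegalLax

end

/-! The 2-cells of `E` at the arrows `i_j` assemble into one natural transformation from `p_m ∘
E_m`, with `p_m` taken for `W`, to `(E_1)^m ∘ p_m`, with `p_m` taken for `V` (`segalComparison`). On
classifying spaces a natural transformation becomes a homotopy (`realize_homotopic`), and a functor
with an adjoint becomes a homotopy equivalence (`isHomotopyEquiv_realize`). So `E_m` and `(E_1)^m`
realize to homotopy equivalences, and `p_m` for `W` is invertible. Cancellation up to homotopy then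
makes `B` of the functor `V_m ⥤ (V_1)^m` a homotopy equivalence
(`isHomotopyEquiv_rectifiedSegalFunctor`). Of the coherence of `E` and `J`, only these 2-cells, the
units and the counits enter.

What remains is to identify `B((V_1)^m)` with the compactly generated power of `B(V_1)`, i.e. that
realization preserves finite products (`exists_homeomorph_KPower`); the binary case also yields the
homotopies. Bijectivity rests on common refinement: finitely many points of simplices are images of
one interior point under monotone maps (`exists_common_refinement`), and an interior point
determines both the monotone map and the simplex carrying it (`eq_of_stdSimplex_map_eq`,
`IsInterior.eq_of_cell_eq`). Continuity of the inverse is reduced to products of cells by currying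
(`continuousGeneratedBy_prod_of_cell`). A product of simplices is in turn a quotient of finitely
many diagonal simplices (`continuous_of_diagonal`). -/

noncomputable section

namespace SegalLax

/-! ### The cells of a geometric realization -/

section Cells

variable {X Y : SSet.{w}} {a b : SimplexCategory}

/-- The characteristic map of a simplex of `X`, from the topological simplex to `|X|`. -/
def cell (x : X.obj (op a)) (t : stdSimplex ℝ (Fin (a.len + 1))) : SSet.toTop.obj X :=
  SSet.toTop.map (SSet.yonedaEquiv.symm x) (a.toTopHomeo.symm t)

lemma continuous_cell (x : X.obj (op a)) : Continuous (cell x) :=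
  (SSet.toTop.map (SSet.yonedaEquiv.symm x)).hom.continuous.comp a.toTopHomeo.symm.continuous

lemma cell_map (f : a ⟶ b) (x : X.obj (op b)) (t : stdSimplex ℝ (Fin (a.len + 1))) :
    cell (X.map f.op x) t = cell x (stdSimplex.map f t) := by
  unfold cell
  rw [SimplexCategory.toTopHomeo_symm_naturality_apply, ← SSet.yonedaEquiv_symm_naturality_left,
    Functor.map_comp]
  rfl

lemma map_cell (φ : X ⟶ Y) (x : X.obj (op a)) (t : stdSimplex ℝ (Fin (a.len + 1))) :
    SSet.toTop.map φ (cell x t) = cell (φ.app _ x) t := by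
  unfold cell
  rw [← SSet.yonedaEquiv_symm_comp, Functor.map_comp]
  rfl

/-- Expresses the adjunction between realization and singular complex through cells. All later facts
about points and topology of `|X|` come from this universal property, not from a model of `|X|`. -/
lemma cell_eq_homEquiv {T : TopCat.{w}} (k : SSet.toTop.obj X ⟶ T) (x : X.obj (op a))
    (t : stdSimplex ℝ (Fin (a.len + 1))) :
    T.toSSetObjEquiv _ ((sSetTopAdj.homEquiv X T k).app (op a) x) t = k (cell x t) := by
  have h := sSetTopAdj_unit_app_app_down X (op a) x
  rw [Adjunction.homEquiv_unit]
  exact congrArg (fun g : SimplexCategory.toTop.{w}.obj a ⟶ SSet.toTop.obj X ↦ k (g (ULift.up t))) h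

/-- A compatible family of continuous maps on the cells of `X` glues to a continuous map. -/
lemma exists_desc {T : TopCat.{w}}
    (g : ∀ (a : SimplexCategory), X.obj (op a) → C(stdSimplex ℝ (Fin (a.len + 1)), T))
    (hg : ∀ {a b : SimplexCategory} (f : a ⟶ b) (x : X.obj (op b)) t,
      g a (X.map f.op x) t = g b x (stdSimplex.map f t)) :
    ∃ k : SSet.toTop.obj X ⟶ T, ∀ (a : SimplexCategory) (x : X.obj (op a)) t,
      k (cell x t) = g a x t := by
  -- The compatible family is a simplicial map into the singular complex of `T`; its transpose is
  -- the glued map.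
  let h : X ⟶ TopCat.toSSet.obj T :=
    { app a := TypeCat.ofHom fun x ↦ (T.toSSetObjEquiv a).symm (g a.unop x)
      naturality := by
        rintro ⟨a⟩ ⟨b⟩ f
        obtain ⟨f, rfl⟩ : ∃ f' : b ⟶ a, f'.op = f := ⟨f.unop, rfl⟩
        ext x
        apply (T.toSSetObjEquiv _).injective
        ext t
        exact hg f x t }
  refine ⟨(sSetTopAdj.homEquiv X T).symm h, fun a x t ↦ ?_⟩
  rw [← cell_eq_homEquiv, Equiv.apply_symm_apply]
  rfl

lemma hom_ext_cell {T : TopCat.{w}} {k l : SSet.toTop.obj X ⟶ T}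
    (h : ∀ (a : SimplexCategory) (x : X.obj (op a)) t, k (cell x t) = l (cell x t)) : k = l := by
  apply (sSetTopAdj.homEquiv X T).injective
  ext ⟨a⟩ x
  apply (T.toSSetObjEquiv _).injective
  ext t
  exact (cell_eq_homEquiv k x t).trans ((h a x t).trans (cell_eq_homEquiv l x t).symm)

/-- A compatible family of functions on the cells of `X` glues to a function. -/
lemma exists_desc_fun {S : Type w}
    (g : ∀ (a : SimplexCategory), X.obj (op a) → stdSimplex ℝ (Fin (a.len + 1)) → S)
    (hg : ∀ {a b : SimplexCategory} (f : a ⟶ b) (x : X.obj (op b)) t,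
      g a (X.map f.op x) t = g b x (stdSimplex.map f t)) :
    ∃ k : SSet.toTop.obj X → S, ∀ (a : SimplexCategory) (x : X.obj (op a)) t,
      k (cell x t) = g a x t := by
  -- The indiscrete topology makes every function continuous, so the topological gluing applies.
  let : TopologicalSpace S := ⊤
  obtain ⟨k, hk⟩ := exists_desc (T := TopCat.of S) (fun a x ↦ ⟨g a x, continuous_top⟩) hg
  exact ⟨k, hk⟩

/-- Maps out of `|X|` are determined on cells. The predicate of lying on a cell and the constant
predicate `True`, as maps to an indiscrete space of propositions, agree there and hence everywhere.
-/
lemma exists_cell (z : SSet.toTop.obj X) :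
    ∃ (a : SimplexCategory) (x : X.obj (op a)) (t : _), cell x t = z := by
  let : TopologicalSpace (ULift.{w} Prop) := ⊤
  let k : SSet.toTop.obj X ⟶ TopCat.of (ULift.{w} Prop) :=
    TopCat.ofHom ⟨fun z ↦ ⟨∃ (a : SimplexCategory) (x : X.obj (op a)) (t : _), cell x t = z⟩,
      continuous_top⟩
  let l : SSet.toTop.obj X ⟶ TopCat.of (ULift.{w} Prop) := TopCat.ofHom ⟨fun _ ↦ ⟨True⟩,
    continuous_top⟩
  have h : k = l := hom_ext_cell fun a x t ↦
    ULift.ext _ _ (eq_true ⟨a, x, t, rfl⟩)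
  exact of_eq_true (congrArg (fun f : SSet.toTop.obj X ⟶ TopCat.of (ULift.{w} Prop) ↦
    (f z).down) h)

/-- The topology of `|X|` is coinduced by the cells. -/
lemma continuous_of_cell {T : Type w} [TopologicalSpace T] {g : SSet.toTop.obj X → T}
    (h : ∀ (a : SimplexCategory) (x : X.obj (op a)), Continuous (g ∘ cell x)) :
    Continuous g := by
  obtain ⟨k, hk⟩ := exists_desc (X := X) (T := TopCat.of T) (fun a x ↦ ⟨g ∘ cell x, h a x⟩)
    (fun f x t ↦ congrArg g (cell_map f x t))
  convert k.hom.continuous using 1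
  funext z
  obtain ⟨a, x, t, rfl⟩ := exists_cell z
  exact (hk a x t).symm

end Cells

/-! ### Common refinements of points of simplices -/

section Refinement

lemma sum_stdSimplex_map {X Y : Type*} [Fintype X] [Fintype Y] [DecidableEq Y] (θ : X → Y)
    (s : stdSimplex ℝ X) (S : Finset Y) :
    ∑ y ∈ S, stdSimplex.map θ s y = ∑ x with θ x ∈ S, s x := by
  simp only [stdSimplex.map_coe, FunOnFinite.linearMap_apply_apply]
  rw [← Finset.sum_fiberwise_of_maps_to (s := Finset.univ.filter fun x ↦ θ x ∈ S) (t := S) (g := θ)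
    (by simp)]
  refine Finset.sum_congr rfl fun y hy ↦ Finset.sum_congr ?_ fun _ _ ↦ rfl
  ext x
  simp only [Finset.mem_filter, Finset.mem_univ, true_and]
  exact ⟨fun h ↦ ⟨h ▸ hy, h⟩, fun h ↦ h.2⟩

lemma eq_of_sum_Iic_eq {n : ℕ} {s t : Fin n → ℝ}
    (h : ∀ i, ∑ k ∈ Finset.Iic i, s k = ∑ k ∈ Finset.Iic i, t k) : s = t := by
  funext i
  induction i using WellFoundedLT.induction with
  | ind i ih =>
    have hi := h i
    rw [← Finset.Iio_insert, Finset.sum_insert (by simp), Finset.sum_insert (by simp),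
      Finset.sum_congr rfl fun k hk ↦ ih k (Finset.mem_Iio.1 hk)] at hi
    exact add_right_cancel hi

/-- The coordinates are successive differences of prescribed partial sums, so increasing thresholds
give positive coordinates. -/
lemma exists_sum_Iic_eq {n : ℕ} (u : Fin (n + 1) → ℝ) :
    ∃ s : Fin (n + 1) → ℝ, (∀ i, ∑ k ∈ Finset.Iic i, s k = u i) ∧ s 0 = u 0 ∧
      ∀ i : Fin n, s i.succ = u i.succ - u i.castSucc := by
  refine ⟨Fin.cases (u 0) fun k ↦ u k.succ - u k.castSucc, fun i ↦ ?_, rfl, fun i ↦ rfl⟩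
  induction i using Fin.induction with
  | zero =>
    have : Finset.Iic (0 : Fin (n + 1)) = {0} := by ext; simp
    rw [this, Finset.sum_singleton, Fin.cases_zero]
  | succ i ih =>
    have : Finset.Iio i.succ = Finset.Iic i.castSucc := by
      ext k
      simp [Fin.lt_def, Fin.le_def]
    rw [← Finset.Iio_insert, Finset.sum_insert (by simp), this, ih, Fin.cases_succ]
    ring

/-- Finitely many points of simplices are the images of a single point in the interior of a
simplex. -/
lemma exists_common_refinement {ι : Type*} [Fintype ι] (p : ι → ℕ)
    (t : ∀ j, stdSimplex ℝ (Fin (p j + 1))) :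
    ∃ (n : ℕ) (s : stdSimplex ℝ (Fin (n + 1))) (θ : ∀ j, Fin (n + 1) →o Fin (p j + 1)),
      n ≤ ∑ j, (p j + 1) ∧ (∀ k, 0 < s k) ∧ ∀ j, stdSimplex.map (θ j) s = t j := by
  classical
  -- Points are encoded by their cumulative sums: these cut the unit interval, and a common
  -- refinement is the union of all the cuts.
  let c (j : ι) (i : Fin (p j + 1)) : ℝ := ∑ k ∈ Finset.Iic i, t j k
  have c_mono (j) : Monotone (c j) := fun i i' h ↦
    Finset.sum_le_sum_of_subset_of_nonneg (Finset.Iic_subset_Iic.2 h) (by simp)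
  have c_last (j) : c j (Fin.last _) = 1 := by
    rw [← stdSimplex.sum_eq_one (t j)]
    exact Finset.sum_congr (by ext; simp [Fin.le_last]) fun _ _ ↦ rfl
  have c_nonneg (j) (i) : 0 ≤ c j i := Finset.sum_nonneg (by simp)
  -- Discarding the value 0 keeps the first coordinate of `s` positive; inserting 1 matters only
  -- when `ι` is empty.
  let S : Finset ℝ := (insert 1 (Finset.univ.biUnion fun j ↦ Finset.univ.image (c j))).filter (0 < ·)
  have mem_S (x : ℝ) : x ∈ S ↔ (x = 1 ∨ ∃ j i, c j i = x) ∧ 0 < x := by simp [S]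
  have one_mem : (1 : ℝ) ∈ S := by simp [mem_S]
  obtain ⟨n, hn⟩ : ∃ n, S.card = n + 1 :=
    Nat.exists_eq_succ_of_ne_zero (Finset.card_ne_zero_of_mem one_mem)
  -- The bound does not depend on `t`; `continuous_of_diagonal` needs this to use only finitely many
  -- simplices.
  have n_le : n ≤ ∑ j, (p j + 1) := by
    have : S.card ≤ ∑ j, (p j + 1) + 1 :=
      (Finset.card_filter_le _ _).trans <| (Finset.card_insert_le _ _).trans <|
        Nat.succ_le_succ <| Finset.card_biUnion_le.trans <| Finset.sum_le_sum fun j _ ↦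
          Finset.card_image_le.trans (by simp)
    lia
  let u : Fin (n + 1) ↪o ℝ := S.orderEmbOfFin hn
  have u_mem (k) : u k ∈ S := S.orderEmbOfFin_mem hn k
  have u_pos (k) : 0 < u k := ((mem_S _).1 (u_mem k)).2
  have u_le (k) : u k ≤ 1 := by
    obtain ⟨h | ⟨j, i, h⟩, -⟩ := (mem_S _).1 (u_mem k)
    · exact h.le
    · rw [← h, ← c_last j]
      exact c_mono j (Fin.le_last i)
  have exists_u {x : ℝ} (hx : x ∈ S) : ∃ k, u k = x := by
    have := S.range_orderEmbOfFin hn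
    rw [Set.ext_iff] at this
    exact (this x).2 hx
  obtain ⟨s, hs, hs₀, hs₁⟩ := exists_sum_Iic_eq u
  have s_pos (k) : 0 < s k := by
    refine Fin.cases ?_ (fun k ↦ ?_) k
    · rw [hs₀]; exact u_pos 0
    · rw [hs₁, sub_pos]
      exact u.lt_iff_lt.2 Fin.castSucc_lt_succ
  have s_sum : ∑ k, s k = 1 := by
    have h : ∑ k, s k = u (Fin.last n) := by
      rw [← hs]
      exact Finset.sum_congr (by ext; simp [Fin.le_last]) fun _ _ ↦ rfl
    obtain ⟨k, hk⟩ := exists_u one_mem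
    exact h.trans (le_antisymm (u_le _) (hk ▸ u.monotone (Fin.le_last k)))
  -- The `k`-th interval of the refinement is sent to the least `i` whose cut `c j i` is at or
  -- beyond its right end `u k`.
  have hθ (j : ι) (k : Fin (n + 1)) : ∃ l, ∀ i, l ≤ i ↔ u k ≤ c j i := by
    have hne : (Finset.univ.filter fun i ↦ u k ≤ c j i).Nonempty :=
      ⟨Fin.last _, by simpa [c_last] using u_le k⟩
    refine ⟨Finset.min' _ hne, fun i ↦ ⟨fun h ↦ ?_, fun h ↦ Finset.min'_le _ _ (by simpa using h)⟩⟩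
    exact (Finset.mem_filter.1 (Finset.min'_mem _ hne)).2.trans (c_mono j h)
  choose θ hθ using hθ
  refine ⟨n, ⟨s, fun k ↦ (s_pos k).le, s_sum⟩, fun j ↦ ⟨θ j, fun k k' h ↦ ?_⟩, n_le, s_pos,
    fun j ↦ ?_⟩
  · rw [hθ]
    exact (u.monotone h).trans ((hθ j k' _).1 le_rfl)
  -- The `i`-th cumulative sum of the image adds up `s k` over `u k ≤ c j i`. This telescopes to `c
  -- j i` if that is a threshold, and is empty if `c j i = 0`.
  · refine stdSimplex.ext (eq_of_sum_Iic_eq fun i ↦ ?_)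
    rw [sum_stdSimplex_map]
    change ∑ k with θ j k ∈ Finset.Iic i, s k = c j i
    simp only [Finset.mem_Iic, hθ]
    obtain h | h := (c_nonneg j i).eq_or_lt
    · rw [← h]
      exact Finset.sum_eq_zero fun k hk ↦ absurd (Finset.mem_filter.1 hk).2 (u_pos k).not_ge
    · obtain ⟨k, hk⟩ := exists_u ((mem_S _).2 ⟨Or.inr ⟨j, i, rfl⟩, h⟩)
      rw [← hk]
      exact (Finset.sum_congr (by ext; simp) fun _ _ ↦ rfl).trans (hs k)

/-- Monotone maps are determined by the image of a point in the interior of the simplex. -/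
lemma eq_of_stdSimplex_map_eq {n p : ℕ} {s : stdSimplex ℝ (Fin (n + 1))} (hs : ∀ k, 0 < s k)
    {θ θ' : Fin (n + 1) →o Fin (p + 1)} (h : stdSimplex.map θ s = stdSimplex.map θ' s) :
    θ = θ' := by
  -- Both sets are initial segments, so one contains the other; they have equal total weight, and
  -- all weights are positive.
  have key (i) : (Finset.univ.filter fun k ↦ θ k ∈ Finset.Iic i) =
      Finset.univ.filter fun k ↦ θ' k ∈ Finset.Iic i := by
    have hsum := congrArg (fun t : stdSimplex ℝ (Fin (p + 1)) ↦ ∑ j ∈ Finset.Iic i, t j) h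
    simp only [sum_stdSimplex_map] at hsum
    have aux {A B : Finset (Fin (n + 1))} (hAB : A ⊆ B) (h : ∑ k ∈ A, s k = ∑ k ∈ B, s k) :
        A = B := by
      by_contra hne
      obtain ⟨k, hk, hk'⟩ := Finset.exists_of_ssubset (hAB.ssubset_of_ne hne)
      exact (Finset.sum_lt_sum_of_subset hAB hk hk' (hs k) fun _ _ _ ↦ (hs _).le).ne h
    have low (φ : Fin (n + 1) →o Fin (p + 1)) : IsLowerSet {k | φ k ≤ i} :=
      fun a b hab ha ↦ (φ.monotone hab).trans ha
    obtain hl | hl := (low θ).total (low θ')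
    · exact aux (fun k hk ↦ by simpa using hl (by simpa using hk)) hsum
    · exact (aux (fun k hk ↦ by simpa using hl (by simpa using hk)) hsum.symm).symm
  have key' (i k) : θ k ≤ i ↔ θ' k ≤ i := by simpa using Finset.ext_iff.1 (key i) k
  ext k : 2
  exact le_antisymm ((key' _ k).2 le_rfl) ((key' _ k).1 le_rfl)

variable {a b : SimplexCategory}

/-- A point of a topological simplex is interior if all its barycentric coordinates are positive. -/
def IsInterior (s : stdSimplex ℝ (Fin (a.len + 1))) : Prop := ∀ k, 0 < s k

lemma exists_refinement {ι : Type*} [Finite ι] (p : ι → SimplexCategory)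
    (t : ∀ j, stdSimplex ℝ (Fin ((p j).len + 1))) :
    ∃ (c : SimplexCategory) (s : stdSimplex ℝ (Fin (c.len + 1))) (θ : ∀ j, c ⟶ p j),
      IsInterior s ∧ ∀ j, stdSimplex.map (θ j) s = t j := by
  cases nonempty_fintype ι
  obtain ⟨n, s, θ, -, hs, h⟩ := exists_common_refinement (fun j ↦ (p j).len) t
  exact ⟨⦋n⦌, s, fun j ↦ SimplexCategory.Hom.mk (θ j), hs, h⟩

lemma exists_refinement₂ (s : stdSimplex ℝ (Fin (a.len + 1)))
    (t : stdSimplex ℝ (Fin (b.len + 1))) :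
    ∃ (c : SimplexCategory) (r : stdSimplex ℝ (Fin (c.len + 1))) (θ : c ⟶ a) (θ' : c ⟶ b),
      IsInterior r ∧ stdSimplex.map θ r = s ∧ stdSimplex.map θ' r = t := by
  obtain ⟨c, r, θ, hr, h⟩ := exists_refinement (ι := Bool) (fun i ↦ bif i then a else b)
    (fun i ↦ match i with
      | true => s
      | false => t)
  exact ⟨c, r, θ true, θ false, hr, h true, h false⟩

lemma IsInterior.hom_ext {s : stdSimplex ℝ (Fin (a.len + 1))} (hs : IsInterior s) {θ θ' : a ⟶ b}
    (h : stdSimplex.map θ s = stdSimplex.map θ' s) : θ = θ' :=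
  SimplexCategory.Hom.ext _ _ (eq_of_stdSimplex_map_eq hs h)

/-- A vertex missed by `θ` would have barycentric coordinate zero in the image. -/
lemma IsInterior.epi {s : stdSimplex ℝ (Fin (b.len + 1))} (hs : IsInterior s) {θ : a ⟶ b}
    {r : stdSimplex ℝ (Fin (a.len + 1))} (h : stdSimplex.map θ r = s) : Epi θ := by
  rw [SimplexCategory.epi_iff_surjective]
  intro i
  have hi := hs i
  rw [← h, stdSimplex.map_coe, FunOnFinite.linearMap_apply_apply] at hi
  obtain ⟨k, hk, -⟩ := Finset.exists_ne_zero_of_sum_ne_zero hi.ne'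
  exact ⟨k, (Finset.mem_filter.1 hk).2⟩

lemma stdSimplex_map_comp {c : SimplexCategory} (f : a ⟶ b) (g : b ⟶ c)
    (s : stdSimplex ℝ (Fin (a.len + 1))) :
    stdSimplex.map (f ≫ g) s = stdSimplex.map g (stdSimplex.map f s) :=
  (stdSimplex.map_comp_apply f g s).symm

end Refinement

/-! ### Equality of points in a geometric realization -/

section CellEq

variable {X : SSet.{w}} {a b : SimplexCategory}

/-- Two points of cells of `X` are identified if they agree on a common interior refinement. -/
def CellRel (X : SSet.{w})
    (p q : Σ a : SimplexCategory, X.obj (op a) × stdSimplex ℝ (Fin (a.len + 1))) : Prop :=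
  ∃ (c : SimplexCategory) (r : stdSimplex ℝ (Fin (c.len + 1))) (θ : c ⟶ p.1) (θ' : c ⟶ q.1),
    IsInterior r ∧ stdSimplex.map θ r = p.2.2 ∧ stdSimplex.map θ' r = q.2.2 ∧
      X.map θ.op p.2.1 = X.map θ'.op q.2.1

variable (X) in
-- For transitivity, the two given refinements are refined further. The two resulting monotone maps
-- to the middle simplex agree at an interior point, so they are equal and the two identities of
-- simplices can be chained.
lemma cellRel_equivalence : Equivalence (CellRel X) where
  refl p := by
    obtain ⟨c, r, θ, -, hr, h, -⟩ := exists_refinement₂ p.2.2 p.2.2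
    exact ⟨c, r, θ, θ, hr, h, h, rfl⟩
  symm := by
    rintro p q ⟨c, r, θ, θ', hr, h, h', hX⟩
    exact ⟨c, r, θ', θ, hr, h', h, hX.symm⟩
  trans := by
    rintro ⟨_, x, s⟩ ⟨_, y, t⟩ ⟨_, z, t'⟩ ⟨c, r, θ₁, θ₂, hr, h₁, h₂, h⟩
      ⟨c', r', θ₃, θ₄, hr', h₃, h₄, h'⟩
    dsimp only at *
    obtain ⟨d, v, α, β, hv, hα, hβ⟩ := exists_refinement₂ r r'
    have e : α ≫ θ₂ = β ≫ θ₃ := hv.hom_ext (by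
      rw [stdSimplex_map_comp, stdSimplex_map_comp, hα, hβ, h₂, h₃])
    refine ⟨d, v, α ≫ θ₁, β ≫ θ₄, hv, by rw [stdSimplex_map_comp, hα, h₁],
      by rw [stdSimplex_map_comp, hβ, h₄], ?_⟩
    have e' : X.map (α ≫ θ₂).op y = X.map (β ≫ θ₃).op y := by rw [e]
    simp only [op_comp, Functor.map_comp_apply] at e' ⊢
    rw [h, e', h']

/-- The class map to the quotient by `CellRel` is compatible with simplicial operators, so it
descends to `|X|` and separates inequivalent representatives. -/
lemma cellRel_of_cell_eq {x : X.obj (op a)} {y : X.obj (op b)}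
    {s : stdSimplex ℝ (Fin (a.len + 1))} {t : stdSimplex ℝ (Fin (b.len + 1))}
    (h : cell x s = cell y t) : CellRel X ⟨a, x, s⟩ ⟨b, y, t⟩ := by
  let S : Setoid (Σ a : SimplexCategory, X.obj (op a) × stdSimplex ℝ (Fin (a.len + 1))) :=
    ⟨CellRel X, cellRel_equivalence X⟩
  obtain ⟨k, hk⟩ := exists_desc_fun (X := X) (S := Quotient S) (fun a x s ↦ ⟦⟨a, x, s⟩⟧) (by
    intro a b f x t
    obtain ⟨c, r, θ, -, hr, hθ, -⟩ := exists_refinement₂ t t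
    refine Quotient.sound ⟨c, r, θ, θ ≫ f, hr, hθ, by rw [stdSimplex_map_comp, hθ], ?_⟩
    simp)
  exact Quotient.exact ((hk a x s).symm.trans ((congrArg k h).trans (hk b y t)))

/-- The characteristic maps are jointly injective on interior points, in each dimension. -/
lemma IsInterior.eq_of_cell_eq {s : stdSimplex ℝ (Fin (a.len + 1))} (hs : IsInterior s)
    {x y : X.obj (op a)} (h : cell x s = cell y s) : x = y := by
  obtain ⟨c, r, θ, θ', hr, h₁, h₂, e⟩ := cellRel_of_cell_eq h
  obtain rfl : θ = θ' := hr.hom_ext (h₁.trans h₂.symm)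
  have := hs.epi h₁
  -- Epimorphisms of the simplex category split, so restricting along a section of `θ` recovers `x`
  -- and `y`.
  have := isSplitEpi_of_epi θ
  have e' := congrArg (X.map (section_ θ).op) e
  dsimp only at e'
  rwa [← Functor.map_comp_apply, ← Functor.map_comp_apply, ← op_comp,
    IsSplitEpi.id, op_id, Functor.map_id_apply, Functor.map_id_apply] at e'

end CellEq

/-! ### Continuity on compactly generated products of realizations -/

section KContinuous

open Topology

/-- The family of compact Hausdorff spaces, indexed by itself. -/
abbrev compHausFamily (K : CompHaus.{w}) : Type w := K

instance isGeneratedBy_of_compact (K : Type w) [TopologicalSpace K] [CompactSpace K] [T2Space K] :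
    IsGeneratedBy compHausFamily.{w} K :=
  inferInstanceAs (IsGeneratedBy compHausFamily.{w} (compHausFamily (CompHaus.of K)))

lemma locallyCompactSpace_of_compact (K : Type*) [TopologicalSpace K] [CompactSpace K]
    [T2Space K] : LocallyCompactSpace K := inferInstance

instance locallyCompactSpace_compHausFamily (K : CompHaus.{w}) :
    LocallyCompactSpace (compHausFamily K) :=
  locallyCompactSpace_of_compact K

instance isGeneratedBy_prod (K L : CompHaus.{w}) :
    IsGeneratedBy compHausFamily.{w} (compHausFamily K × compHausFamily L) :=
  isGeneratedBy_of_compact (K × L)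

/-- Simplices and the unit interval live in the lowest universe, and are lifted to that of the
generating family. -/
instance isGeneratedBy_of_compact_zero (K : Type) [TopologicalSpace K] [CompactSpace K]
    [T2Space K] : IsGeneratedBy compHausFamily.{w} K :=
  Homeomorph.ulift.{w}.isQuotientMap.isGeneratedBy

lemma continuous_of_continuousGeneratedBy {Y Z : Type*} [TopologicalSpace Y] [TopologicalSpace Z]
    [IsGeneratedBy compHausFamily.{w} Y] {g : Y → Z}
    (h : ContinuousGeneratedBy compHausFamily.{w} g) : Continuous g :=
  (IsGeneratedBy.continuous_iff compHausFamily.{w} g).2 h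

instance isGeneratedBy_toTop (X : SSet.{w}) :
    IsGeneratedBy compHausFamily.{w} (SSet.toTop.obj X) where
  continuous_equiv_symm := continuous_of_cell fun _ x ↦
    (IsGeneratedBy.equiv_symm_comp_continuous_iff compHausFamily.{w} _).2 (continuous_cell x)

/-- A map out of a compactly generated product of realizations is continuous if it is so on each
product of cells. -/
lemma continuousGeneratedBy_prod_of_cell {T : Type w} [TopologicalSpace T] {m : ℕ} :
    ∀ (X : Fin m → SSet.{w}) (K : Type w) [TopologicalSpace K] [CompactSpace K] [T2Space K]
      (φ : K × (∀ j, SSet.toTop.obj (X j)) → T)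
      (_ : ∀ (a : Fin m → SimplexCategory) (x : ∀ j, (X j).obj (op (a j))),
        Continuous fun (p : K × ∀ j, stdSimplex ℝ (Fin ((a j).len + 1))) ↦
          φ (p.1, fun j ↦ cell (x j) (p.2 j))),
      ContinuousGeneratedBy compHausFamily.{w} φ := by
  induction m with
  | zero =>
    intro X K _ _ _ φ h
    have h' := h Fin.elim0 (fun j ↦ j.elim0)
    refine Continuous.continuousGeneratedBy ?_
    have h₂ : Continuous fun p : K × (∀ j, SSet.toTop.obj (X j)) ↦
      ((p.1, fun j ↦ j.elim0) : K × ∀ j : Fin 0, stdSimplex ℝ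
        (Fin (SimplexCategory.len (Fin.elim0 j) + 1))) := by fun_prop
    convert h'.comp h₂ using 1
    funext p
    exact congrArg φ (Prod.ext rfl (Subsingleton.elim _ _))
  | succ m ih =>
    intro X K _ _ _ φ h
    let Y := K × ∀ j : Fin m, SSet.toTop.obj (X j.succ)
    have h₁ (a : SimplexCategory) (x : (X 0).obj (op a)) :
        ContinuousGeneratedBy compHausFamily.{w}
          fun p : Y × stdSimplex ℝ (Fin (a.len + 1)) ↦
            φ (p.1.1, Fin.cons (cell x p.2) p.1.2) := by
      -- The simplex of the first factor is absorbed into the compact parameter, which is why the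
      -- induction allows an arbitrary `K`.
      have := ih (fun j ↦ X j.succ) (K × stdSimplex ℝ (Fin (a.len + 1)))
        (fun p ↦ φ (p.1.1, Fin.cons (cell x p.1.2) p.2)) (fun b y ↦ by
          have := (h (Fin.cons a b) (Fin.cons x y)).comp
            (f := fun p : (K × stdSimplex ℝ (Fin (a.len + 1))) ×
              (∀ j, stdSimplex ℝ (Fin ((b j).len + 1))) ↦ (p.1.1,
                (Fin.cons p.1.2 p.2 : ∀ j : Fin (m + 1), stdSimplex ℝ
                  (Fin (SimplexCategory.len (Fin.cons (α := fun _ ↦ SimplexCategory) a b j) + 1)))))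
            (by
              refine Continuous.prodMk (by fun_prop) (continuous_pi fun j ↦ ?_)
              refine Fin.cases ?_ (fun j ↦ ?_) j
              · exact continuous_snd.comp continuous_fst
              · exact (continuous_apply j).comp continuous_snd)
          convert this using 1
          funext p
          refine congrArg φ (Prod.ext rfl (funext fun j ↦ ?_))
          refine Fin.cases ?_ (fun j ↦ ?_) j <;> rfl)
      exact this.comp (Continuous.continuousGeneratedBy
        (g := fun p : Y × stdSimplex ℝ (Fin (a.len + 1)) ↦ ((p.1.1, p.2), p.1.2))
        (by dsimp only [Y]; fun_prop))
    -- Currying makes the first factor the sole source, so continuity can be tested on its cells;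
    -- uncurrying then returns `φ`.
    let g (z : SSet.toTop.obj (X 0)) : ContinuousMapGeneratedBy compHausFamily.{w} Y T :=
      ⟨fun y ↦ φ (y.1, Fin.cons z y.2), by
        obtain ⟨a, x, t, rfl⟩ := exists_cell z
        exact (h₁ a x).comp (Continuous.continuousGeneratedBy
          (g := fun y : Y ↦ (y, t)) (by fun_prop))⟩
    have hg : Continuous g := continuous_of_cell fun a x ↦
      continuous_of_continuousGeneratedBy
        (ContinuousMapGeneratedBy.curryEquiv ⟨_, h₁ a x⟩).prop
    have h₂ := (ContinuousMapGeneratedBy.curryEquiv.symm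
      (⟨g, hg.continuousGeneratedBy⟩ : ContinuousMapGeneratedBy compHausFamily.{w} _ _)).prop
    have h₃ := h₂.comp (Continuous.continuousGeneratedBy
      (g := fun p : K × (∀ j, SSet.toTop.obj (X j)) ↦
        (((p.1, fun j ↦ p.2 j.succ), p.2 0) : Y × _)) (by fun_prop))
    convert h₃ using 1
    funext p
    exact congrArg φ (Prod.ext rfl (Fin.cons_self_tail p.2).symm)

end KContinuous

/-! ### Realization and finite products -/

section Products

open Topology

variable {ι : Type*} {P : SSet.{w}} {X : ι → SSet.{w}}

/-- `P` is the product of the simplicial sets `X j`, with projections `π j`. -/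
def IsProduct (π : ∀ j, P ⟶ X j) : Prop :=
  ∀ a : SimplexCategory, Function.Bijective fun (x : P.obj (op a)) j ↦ (π j).app (op a) x

/-- The comparison map from the realization of a product to the product of the realizations. -/
def comparison (π : ∀ j, P ⟶ X j) (z : SSet.toTop.obj P) (j : ι) : SSet.toTop.obj (X j) :=
  SSet.toTop.map (π j) z

variable {π : ∀ j, P ⟶ X j}

lemma comparison_cell {a : SimplexCategory} (x : P.obj (op a))
    (t : stdSimplex ℝ (Fin (a.len + 1))) :
    comparison π (cell x t) = fun j ↦ cell ((π j).app _ x) t :=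
  funext fun j ↦ map_cell (π j) x t

lemma continuous_comparison : Continuous (comparison π) :=
  continuous_pi fun j ↦ (SSet.toTop.map (π j)).hom.continuous

/-- Both halves move the data to one simplex by refinement. Injectivity then uses that cells
separate simplices at an interior point; surjectivity assembles the restricted simplices into one of
`P`. -/
lemma comparison_bijective [Finite ι] (hπ : IsProduct π) :
    Function.Bijective (comparison π) := by
  constructor
  · intro z z' h
    obtain ⟨a, x, s, rfl⟩ := exists_cell z
    obtain ⟨b, y, t, rfl⟩ := exists_cell z'
    obtain ⟨c, r, θ, θ', hr, rfl, rfl⟩ := exists_refinement₂ s t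
    rw [← cell_map, ← cell_map] at h ⊢
    rw [comparison_cell, comparison_cell] at h
    exact congrArg (cell · r) ((hπ c).1 (funext fun j ↦ hr.eq_of_cell_eq (congrFun h j)))
  · intro z
    choose a x t h using fun j ↦ exists_cell (z j)
    obtain ⟨c, r, θ, -, hθ⟩ := exists_refinement a t
    obtain ⟨p, hp⟩ := (hπ c).2 fun j ↦ (X j).map (θ j).op (x j)
    refine ⟨cell p r, funext fun j ↦ ?_⟩
    rw [comparison_cell, ← h, ← hθ, ← cell_map, ← congrFun hp j]

/-- A function on a finite product of simplices is continuous if it is continuous along each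
simplex mapping diagonally to that product. -/
lemma continuous_of_diagonal {T : Type*} [TopologicalSpace T] [Finite ι] (p : ι → ℕ)
    (φ : (∀ j, stdSimplex ℝ (Fin (p j + 1))) → T)
    (h : ∀ (n : ℕ) (θ : ∀ j, Fin (n + 1) →o Fin (p j + 1)),
      Continuous fun r : stdSimplex ℝ (Fin (n + 1)) ↦ φ fun j ↦ stdSimplex.map (θ j) r) :
    Continuous φ := by
  cases nonempty_fintype ι
  -- Diagonal simplices of dimension at most `N` are finite in number, so their disjoint union is
  -- compact. Its continuous surjection onto the Hausdorff product is therefore a quotient map.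
  generalize hN : ∑ j, (p j + 1) = N
  have (n : ℕ) (j : ι) : Finite (Fin (n + 1) →o Fin (p j + 1)) := DFunLike.finite _
  let q (d : Σ i : (Σ n : Fin (N + 1), ∀ j, Fin (n.1 + 1) →o Fin (p j + 1)),
    stdSimplex ℝ (Fin (i.1.1 + 1))) (j : ι) : stdSimplex ℝ (Fin (p j + 1)) :=
      stdSimplex.map (d.1.2 j) d.2
  have q_cont : Continuous q := by
    refine continuous_sigma fun i ↦ ?_
    have (j : ι) : Continuous (stdSimplex.map (S := ℝ) (i.2 j)) := stdSimplex.continuous_map _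
    exact continuous_pi this
  have q_surj : Function.Surjective q := fun t ↦ by
    obtain ⟨n, s, θ, hn, -, hθ⟩ := exists_common_refinement p t
    exact ⟨⟨⟨⟨n, Nat.lt_succ_of_le (hn.trans hN.le)⟩, θ⟩, s⟩, funext hθ⟩
  rw [(IsQuotientMap.of_surjective_continuous q_surj q_cont).continuous_iff]
  exact continuous_sigma fun i ↦ h i.1.1 i.2

variable {m : ℕ} {X : Fin m → SSet.{w}} {π : ∀ j, P ⟶ X j}

/-- Along a diagonal simplex in a product of cells, `ψ` is a characteristic map of `P`, hence
continuous. -/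
lemma continuousGeneratedBy_comparison_symm (hπ : IsProduct π)
    (ψ : (∀ j, SSet.toTop.obj (X j)) → SSet.toTop.obj P)
    (hψ : ∀ z, ψ (comparison π z) = z) : ContinuousGeneratedBy compHausFamily.{w} ψ := by
  refine (continuousGeneratedBy_prod_of_cell X PUnit.{w + 1} (ψ ∘ Prod.snd)
    fun a x ↦ ?_).comp (Continuous.continuousGeneratedBy
      (g := fun y : (∀ j, SSet.toTop.obj (X j)) ↦ (PUnit.unit.{w + 1}, y)) (by fun_prop))
  refine (continuous_of_diagonal (fun j ↦ (a j).len) (fun t ↦ ψ fun j ↦ cell (x j) (t j))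
    fun n θ₀ ↦ ?_).comp continuous_snd
  let θ (j : Fin m) : ⦋n⦌ ⟶ a j := SimplexCategory.Hom.mk (θ₀ j)
  obtain ⟨p, hp⟩ := (hπ ⦋n⦌).2 fun j ↦ (X j).map (θ j).op (x j)
  convert continuous_cell p using 1
  funext r
  rw [← hψ (cell p r), comparison_cell]
  refine congrArg ψ (funext fun j ↦ ?_)
  exact (cell_map (θ j) (x j) r).symm.trans (congrArg (cell · r) (congrFun hp j).symm)

/-- The realization of a finite power, in simplicial sets, is the compactly generated power of the
realization. -/
lemma exists_homeomorph_KPower {Y : SSet.{w}} {π : Fin m → (P ⟶ Y)} (hπ : IsProduct π) :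
    ∃ e : SSet.toTop.obj P ≃ₜ KPower (SSet.toTop.obj Y) m,
      ∀ z, e z = WithGeneratedByTopology.equiv.symm fun j ↦ SSet.toTop.map (π j) z := by
  let e₀ := Equiv.ofBijective _ (comparison_bijective hπ)
  refine ⟨⟨e₀.trans WithGeneratedByTopology.equiv.symm, ?_, ?_⟩, fun z ↦ rfl⟩
  · change Continuous (WithGeneratedByTopology.equiv.symm ∘ comparison π)
    exact (IsGeneratedBy.equiv_symm_comp_continuous_iff compHausFamily.{w} _).2
      continuous_comparison
  · exact continuous_of_continuousGeneratedBy
      ((continuousGeneratedBy_comparison_symm hπ e₀.symm e₀.symm_apply_apply).comp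
      WithGeneratedByTopology.continuous_equiv.continuousGeneratedBy)

end Products

/-! ### Natural transformations and homotopies -/

section Homotopies

open Topology

lemma exists_binary_product_inverse {P A B : SSet.{w}} (p : P ⟶ A) (q : P ⟶ B)
    (h : ∀ a : SimplexCategory, Function.Bijective fun x : P.obj (op a) ↦
      (p.app (op a) x, q.app (op a) x)) :
    ∃ ψ : SSet.toTop.obj A × SSet.toTop.obj B → SSet.toTop.obj P,
      ContinuousGeneratedBy compHausFamily.{w} ψ ∧
        ∀ z, ψ (SSet.toTop.map p z, SSet.toTop.map q z) = z := by
  let X : Fin 2 → SSet.{w} := Fin.cons A fun _ ↦ B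
  let π : ∀ j, P ⟶ X j := Fin.cons (α := fun j ↦ P ⟶ X j) p fun _ ↦ q
  have hπ : IsProduct π := by
    refine fun a ↦ ⟨fun x y hxy ↦ (h a).1 (Prod.ext (congrFun hxy 0) (congrFun hxy 1)),
      fun y ↦ ?_⟩
    obtain ⟨x, hx⟩ := (h a).2 (y 0, y 1)
    refine ⟨x, funext fun j ↦ ?_⟩
    fin_cases j
    · exact congrArg Prod.fst hx
    · exact congrArg Prod.snd hx
  let e := Equiv.ofBijective _ (comparison_bijective hπ)
  have he := continuousGeneratedBy_comparison_symm hπ e.symm e.symm_apply_apply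
  let c (y : SSet.toTop.obj A × SSet.toTop.obj B) : ∀ j, SSet.toTop.obj (X j) :=
    Fin.cons (α := fun j ↦ SSet.toTop.obj (X j)) y.1 fun _ ↦ y.2
  have hc : Continuous c := continuous_pi fun j ↦ by
    fin_cases j
    · exact continuous_fst
    · exact continuous_snd
  refine ⟨e.symm ∘ c, he.comp hc.continuousGeneratedBy, fun z ↦ ?_⟩
  refine (congrArg e.symm (funext fun j ↦ ?_)).trans (e.symm_apply_apply z)
  fin_cases j <;> rfl

/-- Compactness of `K` allows currying to `C(K, T)`, and continuity out of `|X|` is tested on cells.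
The homotopy thus becomes continuous on the ordinary product with the interval, as
`ContinuousMap.Homotopy` demands. -/
lemma continuous_prod_of_cell {X : SSet.{w}} {K : Type} [TopologicalSpace K] [CompactSpace K]
    [T2Space K] {T : Type w} [TopologicalSpace T] {f : K × SSet.toTop.obj X → T}
    (h : ∀ (a : SimplexCategory) (x : X.obj (op a)),
      Continuous fun p : K × stdSimplex ℝ (Fin (a.len + 1)) ↦ f (p.1, cell x p.2)) :
    Continuous f := by
  let g (z : SSet.toTop.obj X) : C(K, T) := ⟨fun s ↦ f (s, z), by
    obtain ⟨a, x, t, rfl⟩ := exists_cell z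
    exact (h a x).comp (by fun_prop : Continuous fun s : K ↦ (s, t))⟩
  have hg : Continuous g := continuous_of_cell fun a x ↦
    (ContinuousMap.curry ⟨fun p : stdSimplex ℝ (Fin (a.len + 1)) × K ↦ f (p.2, cell x p.1),
      (h a x).comp continuous_swap⟩).continuous
  exact (ContinuousMap.continuous_uncurry_of_continuous ⟨g, hg⟩).comp continuous_swap

lemma cell_const {X : SSet.{w}} (x : X _⦋0⦌) {a : SimplexCategory} (f : a ⟶ ⦋0⦌)
    (t : stdSimplex ℝ (Fin (a.len + 1))) :
    cell (X.map f.op x) t = cell x (stdSimplex.vertex 0) := by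
  rw [cell_map]
  congr 1
  exact Subsingleton.elim (α := stdSimplex ℝ (Fin 1)) _ _

lemma cell_vertex {X : SSet.{w}} (e : X _⦋1⦌) (i : Fin 2) :
    cell e (stdSimplex.vertex (S := ℝ) i) =
      cell (X.map (SimplexCategory.const ⦋0⦌ ⦋1⦌ i).op e) (stdSimplex.vertex 0) := by
  rw [cell_map]
  congr 1
  exact (stdSimplex.map_vertex (S := ℝ) (SimplexCategory.const ⦋0⦌ ⦋1⦌ i) 0).symm

variable {C D E : Type u} [Category.{v} C] [Category.{v} D] [Category.{v} E]

/-- The continuous map of classifying spaces induced by a functor. -/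
def realize (F : C ⥤ D) : C(SSet.toTop.obj (nerve C), SSet.toTop.obj (nerve D)) :=
  (SSet.toTop.map (nerveMap F)).hom

lemma realize_id : realize (𝟭 C) = .id _ := by
  have : nerveMap (𝟭 C) = 𝟙 _ := rfl
  rw [realize, this, CategoryTheory.Functor.map_id]
  rfl

lemma realize_comp (F : C ⥤ D) (G : D ⥤ E) : realize (F ⋙ G) = (realize G).comp (realize F) := by
  have : nerveMap (F ⋙ G) = nerveMap F ≫ nerveMap G := rfl
  rw [realize, this, CategoryTheory.Functor.map_comp]
  rfl

/-- The category with two objects and one non-identity arrow. -/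
structure Arr : Type u where
  down : Fin 2

instance : Category.{v} Arr.{u} where
  Hom i j := ULift.{v} (PLift (i.down ≤ j.down))
  id i := ⟨⟨le_rfl⟩⟩
  comp f g := ⟨⟨f.down.down.trans g.down.down⟩⟩

instance : Quiver.IsThin Arr.{u} := fun i j ↦
  inferInstanceAs (Subsingleton (ULift (PLift (i.down ≤ j.down))))

/-- The functor from `Arr` to the ordinal with two elements. -/
def Arr.toFin : Arr.{u} ⥤ Fin 2 where
  obj i := i.down
  map f := homOfLE f.down.down

/-- The functor on `Arr × C` corresponding to a natural transformation. -/
def cylinder {F G : C ⥤ D} (α : F ⟶ G) : Arr.{u} × C ⥤ D :=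
  Functor.uncurry.obj (Arr.toFin ⋙ ComposableArrows.mk₁ α)

/-- The inclusion of an end of the cylinder `Arr × C`. -/
def cylinderIncl (C : Type u) [Category.{v} C] (i : Fin 2) : C ⥤ Arr.{u} × C :=
  Functor.prod' ((Functor.const C).obj ⟨i⟩) (𝟭 C)

lemma cylinderIncl_comp_zero {F G : C ⥤ D} (α : F ⟶ G) :
    cylinderIncl C 0 ⋙ cylinder α = F :=
  Functor.hext (fun _ ↦ rfl) fun X Y f ↦ heq_of_eq (by
    change ((ComposableArrows.mk₁ α).map (𝟙 0)).app X ≫ F.map f = F.map f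
    rw [CategoryTheory.Functor.map_id]
    exact Category.id_comp (F.map f))

lemma cylinderIncl_comp_one {F G : C ⥤ D} (α : F ⟶ G) :
    cylinderIncl C 1 ⋙ cylinder α = G :=
  Functor.hext (fun _ ↦ rfl) fun X Y f ↦ heq_of_eq (by
    change ((ComposableArrows.mk₁ α).map (𝟙 1)).app X ≫ G.map f = G.map f
    rw [CategoryTheory.Functor.map_id]
    exact Category.id_comp (G.map f))

lemma nerve_prod_bijective (a : SimplexCategory) :
    Function.Bijective fun x : (nerve (C × D)).obj (op a) ↦
      ((nerveMap (CategoryTheory.Prod.fst C D)).app (op a) x,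
        (nerveMap (CategoryTheory.Prod.snd C D)).app (op a) x) := by
  constructor
  · intro x y h
    have h₁ : (x : ComposableArrows (C × D) a.len) ⋙ CategoryTheory.Prod.fst C D =
      (y : ComposableArrows (C × D) a.len) ⋙ CategoryTheory.Prod.fst C D := congrArg Prod.fst h
    have h₂ : (x : ComposableArrows (C × D) a.len) ⋙ CategoryTheory.Prod.snd C D =
      (y : ComposableArrows (C × D) a.len) ⋙ CategoryTheory.Prod.snd C D := congrArg Prod.snd h
    have h₃ : ∀ x : ComposableArrows (C × D) a.len, x = Functor.prod'
      (x ⋙ CategoryTheory.Prod.fst C D) (x ⋙ CategoryTheory.Prod.snd C D) := fun _ ↦ rfl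
    exact (h₃ x).trans ((congrArg₂ Functor.prod' h₁ h₂).trans (h₃ y).symm)
  · exact fun y ↦ ⟨Functor.prod' y.1 y.2, rfl⟩

lemma nerve_pi_isProduct {ι : Type} (C : Type u) [Category.{v} C] :
    IsProduct fun j : ι ↦ nerveMap (Pi.eval (fun _ ↦ C) j) := by
  refine fun a ↦ ⟨fun x y h ↦ ?_, fun y ↦ ⟨Functor.pi' y, rfl⟩⟩
  exact Functor.pi_ext (x : ComposableArrows (ι → C) a.len) y fun j ↦ congrFun h j

/-- A natural transformation induces a homotopy of maps of classifying spaces. -/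
lemma realize_homotopic {F G : C ⥤ D} (α : F ⟶ G) : (realize F).Homotopic (realize G) := by
  obtain ⟨ψ, hψ, hψ'⟩ := exists_binary_product_inverse _ _
    (nerve_prod_bijective (C := Arr.{u}) (D := C))
  let e : (nerve Arr.{u}) _⦋1⦌ := ComposableArrows.mk₁ (⟨⟨Fin.zero_le 1⟩⟩ : (⟨0⟩ : Arr.{u}) ⟶ ⟨1⟩)
  -- The interval runs along the edge `e` of `|N Arr|`; `ψ` moves the pair into `|N(Arr × C)|`,
  -- where the cylinder functor applies.
  let h (p : unitInterval × SSet.toTop.obj (nerve C)) : SSet.toTop.obj (nerve D) :=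
    realize (cylinder α) (ψ (cell e (stdSimplexHomeomorphUnitInterval.symm p.1), p.2))
  have h_cont : Continuous h := by
    refine (realize (cylinder α)).continuous.comp (continuous_prod_of_cell fun a x ↦ ?_)
    refine continuous_of_continuousGeneratedBy (hψ.comp (Continuous.continuousGeneratedBy
      (g := fun p : unitInterval × stdSimplex ℝ (Fin (a.len + 1)) ↦
        (cell e (stdSimplexHomeomorphUnitInterval.symm p.1), cell x p.2)) ?_))
    exact ((continuous_cell e).comp (by fun_prop)).prodMk ((continuous_cell x).comp continuous_snd)
  have h_end (i : Fin 2) (z : SSet.toTop.obj (nerve C)) :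
      ψ (cell e (stdSimplex.vertex (S := ℝ) i), z) = realize (cylinderIncl C i) z := by
    obtain ⟨a, x, t, rfl⟩ := exists_cell z
    -- The value of `ψ` is known on pairs of projections of a point, so the pair must be recognized
    -- as those of the included point. In the first coordinate, the simplex constant at `i` realizes
    -- to the vertex.
    refine Eq.trans ?_ (hψ' _)
    congr 2
    · unfold realize
      erw [map_cell, map_cell]
      rw [cell_vertex, ← cell_const _ (SimplexCategory.const a ⦋0⦌ 0)]
      congr 1
      refine nerve.ext_of_isThin (funext fun k ↦ ?_)
      fin_cases i <;> rfl
    · unfold realize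
      erw [map_cell, map_cell]
      rfl
  refine ⟨⟨⟨h, h_cont⟩, fun z ↦ ?_, fun z ↦ ?_⟩⟩
  · have : stdSimplexHomeomorphUnitInterval.symm 0 = stdSimplex.vertex (S := ℝ) (0 : Fin 2) := by
      rw [Homeomorph.symm_apply_eq]; rfl
    change realize (cylinder α) (ψ (cell e (stdSimplexHomeomorphUnitInterval.symm 0), z)) = _
    rw [this, h_end, ← ContinuousMap.comp_apply, ← realize_comp, cylinderIncl_comp_zero]
  · have : stdSimplexHomeomorphUnitInterval.symm 1 = stdSimplex.vertex (S := ℝ) (1 : Fin 2) := by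
      rw [Homeomorph.symm_apply_eq]; rfl
    change realize (cylinder α) (ψ (cell e (stdSimplexHomeomorphUnitInterval.symm 1), z)) = _
    rw [this, h_end, ← ContinuousMap.comp_apply, ← realize_comp, cylinderIncl_comp_one]

end Homotopies

/-! ### Homotopy equivalences -/

section HomotopyEquivalences

/-- The property of a continuous map of being a homotopy equivalence. -/
def IsHomotopyEquiv {X Y : Type*} [TopologicalSpace X] [TopologicalSpace Y] (f : C(X, Y)) : Prop :=
  ∃ g : C(Y, X), (g.comp f).Homotopic (.id X) ∧ (f.comp g).Homotopic (.id Y)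

variable {X Y Z : Type*} [TopologicalSpace X] [TopologicalSpace Y] [TopologicalSpace Z]

/-- The homotopy inverse of `f` is an inverse of `k` composed with `g`. -/
lemma IsHomotopyEquiv.of_comp {f : C(X, Y)} {g : C(Y, Z)} {k : C(X, Z)} (hg : IsHomotopyEquiv g)
    (hk : IsHomotopyEquiv k) (h : (g.comp f).Homotopic k) : IsHomotopyEquiv f := by
  obtain ⟨g', hg₁, hg₂⟩ := hg
  obtain ⟨k', hk₁, hk₂⟩ := hk
  refine ⟨k'.comp g, (((ContinuousMap.Homotopic.refl k').comp h).trans hk₁ :), ?_⟩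
  have h₁ : (f.comp (k'.comp g)).Homotopic (g'.comp (g.comp (f.comp (k'.comp g)))) :=
    hg₁.symm.comp (.refl (f.comp (k'.comp g)))
  have h₂ : (g'.comp (g.comp (f.comp (k'.comp g)))).Homotopic (g'.comp (k.comp (k'.comp g))) :=
    (ContinuousMap.Homotopic.refl g').comp (h.comp (.refl (k'.comp g)))
  have h₃ : (g'.comp (k.comp (k'.comp g))).Homotopic (g'.comp g) :=
    (ContinuousMap.Homotopic.refl g').comp (hk₂.comp (.refl g))
  exact ((h₁.trans h₂).trans h₃).trans hg₁

variable {C D E : Type u} [Category.{v} C] [Category.{v} D] [Category.{v} E]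

/-- Homotopies are reversible, so any transformations between the composites and the identities
suffice; the triangle identities play no role. -/
lemma isHomotopyEquiv_realize (F : C ⥤ D) (G : D ⥤ C) (η : F ⋙ G ⟶ 𝟭 C)
    (η' : 𝟭 D ⟶ G ⋙ F) : IsHomotopyEquiv (realize F) := by
  refine ⟨realize G, ?_, ?_⟩
  · rw [← realize_comp, ← realize_id]
    exact realize_homotopic η
  · rw [← realize_comp, ← realize_id]
    exact (realize_homotopic η').symm

end HomotopyEquivalences

/-! ### The Segal maps of a rectification -/

section Segal

open Topology

variable {W : LaxToCat.{v, u} SimplexCategoryᵒᵖ} (R : Rectification W)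

/-- The functor `E_a : V(a) ⥤ W(a)` of a rectification. -/
def rightFunctor (a : SimplexCategoryᵒᵖ) : R.V.obj a ⥤ W.obj ⟨a⟩ := (R.E.app ⟨a⟩).toFunctor

/-- The functor `J_a : W(a) ⥤ V(a)` of a rectification. -/
def leftFunctor (a : SimplexCategoryᵒᵖ) : W.obj ⟨a⟩ ⥤ R.V.obj a := (R.J.app ⟨a⟩).toFunctor

/-- The unit of `J_a ⊣ E_a`. -/
def adjUnit (a : SimplexCategoryᵒᵖ) : 𝟭 (W.obj ⟨a⟩) ⟶ leftFunctor R a ⋙ rightFunctor R a :=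
  (R.adj a).unit.toNatTrans

/-- The counit of `J_a ⊣ E_a`. -/
def adjCounit (a : SimplexCategoryᵒᵖ) : rightFunctor R a ⋙ leftFunctor R a ⟶ 𝟭 (R.V.obj a) :=
  (R.adj a).counit.toNatTrans

/-- The functor `⟨V(i_1), …, V(i_m)⟩ : V_m ⥤ (V_1)^m`. -/
def rectifiedSegalFunctor (m : ℕ) :
    R.V.obj (op ⦋m⦌) ⥤ (Fin m → R.V.obj (op ⦋1⦌)) :=
  Functor.pi' fun j ↦ (R.V.map (edge m j)).toFunctor

variable (W) in
/-- The functor `⟨W(i_1), …, W(i_m)⟩ : W_m ⥤ (W_1)^m`. -/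
def laxSegalFunctor (m : ℕ) : W.obj ⟨op ⦋m⦌⟩ ⥤ (Fin m → W.obj ⟨op ⦋1⦌⟩) :=
  (segalFunctor W m).toFunctor

/-- The 2-cells of `E` compare `p_m` for `W` and for `V`. -/
def segalComparison (m : ℕ) :
    rightFunctor R (op ⦋m⦌) ⋙ laxSegalFunctor W m ⟶
      rectifiedSegalFunctor R m ⋙ Functor.pi fun _ ↦ rightFunctor R (op ⦋1⦌) :=
  NatTrans.pi' fun j ↦ (R.E.naturality (edge m j).toLoc).toNatTrans

/-- Composing `E_m` with the isomorphism `p_m` of `W` keeps an adjoint: the inverse of `p_m`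
followed by `J_m`. -/
lemma isHomotopyEquiv_segalFunctor_comp (hW : IsSegalLax W) (m : ℕ) :
    IsHomotopyEquiv (realize (rightFunctor R (op ⦋m⦌) ⋙ laxSegalFunctor W m)) := by
  have := hW m
  let Q : (Fin m → W.obj ⟨op ⦋1⦌⟩) ⥤ W.obj ⟨op ⦋m⦌⟩ := (inv (segalFunctor W m)).toFunctor
  have h₁ : laxSegalFunctor W m ⋙ Q = 𝟭 _ :=
    congrArg Cat.Hom.toFunctor (IsIso.hom_inv_id (segalFunctor W m))
  have h₂ : Q ⋙ laxSegalFunctor W m = 𝟭 _ :=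
    congrArg Cat.Hom.toFunctor (IsIso.inv_hom_id (segalFunctor W m))
  refine isHomotopyEquiv_realize _ (Q ⋙ leftFunctor R (op ⦋m⦌)) ?_ ?_
  · exact eqToHom (congrArg
      (fun F ↦ rightFunctor R (op ⦋m⦌) ⋙ F ⋙ leftFunctor R (op ⦋m⦌)) h₁) ≫ adjCounit R _
  · exact eqToHom h₂.symm ≫ Functor.whiskerLeft Q
      (Functor.whiskerRight (adjUnit R _) (laxSegalFunctor W m))

lemma isHomotopyEquiv_pi (m : ℕ) :
    IsHomotopyEquiv (realize (Functor.pi fun _ : Fin m ↦ rightFunctor R (op ⦋1⦌))) :=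
  isHomotopyEquiv_realize _ (Functor.pi fun _ : Fin m ↦ leftFunctor R (op ⦋1⦌))
    (NatTrans.pi fun _ : Fin m ↦ adjCounit R (op ⦋1⦌) :)
    (NatTrans.pi fun _ : Fin m ↦ adjUnit R (op ⦋1⦌) :)

lemma isHomotopyEquiv_rectifiedSegalFunctor (hW : IsSegalLax W) (m : ℕ) :
    IsHomotopyEquiv (realize (rectifiedSegalFunctor R m)) :=
  (isHomotopyEquiv_pi R m).of_comp (isHomotopyEquiv_segalFunctor_comp R hW m) <| by
    rw [← realize_comp]
    exact (realize_homotopic (segalComparison R m)).symm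

end Segal

end SegalLax

end

theorem proposition4p3 (W : SegalLax.LaxToCat.{v, u} SimplexCategoryᵒᵖ)
    (hW : SegalLax.IsSegalLax W) (R : SegalLax.Rectification W) :
    SegalLax.IsSegalSpace (R.V ⋙ SegalLax.classifyingSpace) where
  isPartiallyRealized := ⟨R.V ⋙ nerveFunctor, ⟨Iso.refl _⟩⟩
  homotopyEquiv m := by
    obtain ⟨e, he⟩ := SegalLax.exists_homeomorph_KPower
      (SegalLax.nerve_pi_isProduct (ι := Fin m) (R.V.obj (op ⦋1⦌)))
    obtain ⟨g, hg₁, hg₂⟩ := SegalLax.isHomotopyEquiv_rectifiedSegalFunctor R hW m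
    let f : ContinuousMap.HomotopyEquiv _ _ := ⟨_, g, hg₁, hg₂⟩
    refine ⟨f.trans e.toHomotopyEquiv, funext fun z ↦ (he _).trans ?_⟩
    refine congrArg Topology.WithGeneratedByTopology.equiv.symm (funext fun j ↦ ?_)
    -- The `j`-th coordinate of the composite is the realization of `V(i_j)`, so the equivalence is
    -- the Segal map itself.
    exact congrArg (fun k ↦ k z) (SegalLax.realize_comp (SegalLax.rectifiedSegalFunctor R m)
      (Pi.eval (fun _ ↦ R.V.obj (op ⦋1⦌)) j)).symm
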